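/- Let $H^k=W^{k,2}(\mathbb R)$ be the space of real functions with $L^2$ weak derivatives up to order $k$, with $\|f\|_{H^k}^2=\sum_{j\le k}\|\partial_z^jf\|_{L^2}^2$. For real exponents $n,m$ consider the equation $$\bigl(\phi^m-\partial_z\phi^n\partial_z\bigr)\bigl[\phi^{-m}\phi_t\bigr]=-(\phi^n)_z ,\qquad z\in\mathbb R,\ t\ge 0,$$ equivalently the system $\phi_t=\phi^m u$, $\ -(\phi^n u_z)_z+\phi^m u=-(\phi^n)_z$. A global $H^k$ solution is a function $\phi$ with $\phi-1\in C^1([0,\infty);H^k)$ and $\phi(z,t)>0$ for all $z\in\mathbb R$ and $t\ge0$ (where $\phi(\cdot,t)$ denotes the continuous representative), such that for every $t\ge0$ there is $u(\cdot,t)\in H^1$ that satisfies the second equation of the system in the sense of distributions and the first one, with $\phi_t$ the time derivative in $H^k$. **Theorem.** Let $n,m\in\mathbb R$ be arbitrary. There is $\eta_c=\eta_c(n,m)>0$ such that for every $0<\eta<\eta_c$ there is $\delta=\delta(\eta,n,m)>0$ with the following property. Let $k\in\{1,2\}$ and let $\phi_0$ satisfy $\phi_0-1\in H^k$ and $\|\phi_0-1\|_{H^1}\le\delta$.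 Then there is a unique global $H^k$ solution $\phi$ with $\phi(\cdot,0)=\phi_0$. Moreover, $\|\phi(\cdot,t)-1\|_{H^1}\le\eta$ for all $t\ge 0$. -/

import Mathlib

open MeasureTheory Set
open scoped ContDiff

namespace Magma

/-- `g` is the weak derivative of `f`, for `f, g ∈ L²(ℝ)`. -/
def IsWeakDeriv (f g : Lp ℝ 2 (volume : Measure ℝ)) : Prop :=
  ∀ v : ℝ → ℝ, ContDiff ℝ ∞ v → HasCompactSupport v →
    ∫ z, f z * deriv v z = -∫ z, g z * v z

theorem integrable_mul_test (f : Lp ℝ 2 (volume : Measure ℝ)) {v : ℝ → ℝ}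
    (hv : Continuous v) (hc : HasCompactSupport v) : Integrable (fun z => f z * v z) :=
  (Lp.memLp f).integrable_mul
    (hv.memLp_of_hasCompactSupport hc : MemLp v 2 (volume : Measure ℝ))

theorem IsWeakDeriv.add {f g f' g' : Lp ℝ 2 (volume : Measure ℝ)}
    (h : IsWeakDeriv f g) (h' : IsWeakDeriv f' g') : IsWeakDeriv (f + f') (g + g') := by
  intro v hv hc
  have hv' : Continuous (deriv v) := hv.continuous_deriv (by simp)
  have e1 : ∫ z, (f + f') z * deriv v z = ∫ z, (f z * deriv v z + f' z * deriv v z) := by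
    refine integral_congr_ae ?_
    filter_upwards [Lp.coeFn_add f f'] with z hz
    rw [hz, Pi.add_apply, add_mul]
  have e2 : ∫ z, (g + g') z * v z = ∫ z, (g z * v z + g' z * v z) := by
    refine integral_congr_ae ?_
    filter_upwards [Lp.coeFn_add g g'] with z hz
    rw [hz, Pi.add_apply, add_mul]
  rw [e1, e2, integral_add (integrable_mul_test f hv' hc.deriv)
      (integrable_mul_test f' hv' hc.deriv),
    integral_add (integrable_mul_test g hv.continuous hc)
      (integrable_mul_test g' hv.continuous hc), h v hv hc, h' v hv hc]
  ring

theorem IsWeakDeriv.smul (c : ℝ) {f g : Lp ℝ 2 (volume : Measure ℝ)}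
    (h : IsWeakDeriv f g) : IsWeakDeriv (c • f) (c • g) := by
  intro v hv hc
  have e1 : ∫ z, (c • f) z * deriv v z = ∫ z, c * (f z * deriv v z) := by
    refine integral_congr_ae ?_
    filter_upwards [Lp.coeFn_smul c f] with z hz
    rw [hz, Pi.smul_apply, smul_eq_mul, mul_assoc]
  have e2 : ∫ z, (c • g) z * v z = ∫ z, c * (g z * v z) := by
    refine integral_congr_ae ?_
    filter_upwards [Lp.coeFn_smul c g] with z hz
    rw [hz, Pi.smul_apply, smul_eq_mul, mul_assoc]
  rw [e1, e2, integral_const_mul, integral_const_mul, h v hv hc]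
  ring

theorem IsWeakDeriv.zero : IsWeakDeriv 0 0 := by
  have h : IsWeakDeriv ((0 : ℝ) • (0 : Lp ℝ 2 (volume : Measure ℝ))) ((0 : ℝ) • 0) := by
    intro v hv hc
    have e : ∀ w : ℝ → ℝ,
        ∫ z, ((0 : ℝ) • (0 : Lp ℝ 2 (volume : Measure ℝ))) z * w z = 0 := by
      intro w
      rw [smul_zero, ← integral_zero ℝ ℝ (μ := volume)]
      refine integral_congr_ae ?_
      filter_upwards [Lp.coeFn_zero ℝ 2 (volume : Measure ℝ)] with z hz
      rw [hz, Pi.zero_apply, zero_mul]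
    rw [e, e, neg_zero]
  simpa using h

/-- The Sobolev space `H^k(ℝ) = W^{k,2}(ℝ)` of real-valued functions. An element is a function
in `L²(ℝ)` listed with its weak derivatives of order `1, …, k`, all in `L²(ℝ)`; weak derivatives
are unique, so an element is determined by its component `0`. The norm inherited from the
`ℓ²`-sum is `‖w‖² = ∑_{j ≤ k} ‖∂_z^j w‖²_{L²}`. -/
def sobolev (k : ℕ) :
    Submodule ℝ (PiLp 2 fun _ : Fin (k + 1) => Lp ℝ 2 (volume : Measure ℝ)) where
  carrier := {w | ∀ j : Fin k, IsWeakDeriv (w j.castSucc) (w j.succ)}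
  add_mem' := fun ha hb j => (ha j).add (hb j)
  zero_mem' := fun _ => IsWeakDeriv.zero
  smul_mem' := fun c _ ha j => (ha j).smul c

/-- The weak derivative `∂_z^j w` of `w ∈ H^k(ℝ)`, for `j ≤ k`; `D w 0` is `w` itself. -/
noncomputable def D {k : ℕ} (w : sobolev k) (j : Fin (k + 1)) : ℝ → ℝ :=
  ((w : PiLp 2 fun _ : Fin (k + 1) => Lp ℝ 2 (volume : Measure ℝ)) j :
    Lp ℝ 2 (volume : Measure ℝ))

/-- The `H¹` norm `(‖w‖²_{L²} + ‖∂_z w‖²_{L²})^{1/2}` of an element `w` of `H^k(ℝ)`, `k ≥ 1`. -/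
noncomputable def normH1 {k : ℕ} (w : sobolev k) : ℝ :=
  Real.sqrt (∑ j ∈ Finset.univ.filter (fun j : Fin (k + 1) => j.val ≤ 1),
    ‖(w : PiLp 2 fun _ : Fin (k + 1) => Lp ℝ 2 (volume : Measure ℝ)) j‖ ^ 2)

theorem normH1_eq_norm (w : sobolev 1) : normH1 w = ‖w‖ := by
  rw [normH1, Submodule.coe_norm, PiLp.norm_eq_of_L2]
  exact congrArg Real.sqrt
    (Finset.sum_congr (Finset.filter_true_of_mem fun j _ => by omega) fun _ _ => rfl)

/-- The porosity `φ = 1 + w` at a fixed time. -/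
noncomputable def porosity {k : ℕ} (w : sobolev k) : ℝ → ℝ := fun z => 1 + D w 0 z

/-- `u ∈ H¹(ℝ)` solves `-(φⁿ u_z)_z + φᵐ u = -(φⁿ)_z` in the sense of distributions. -/
def SolvesElliptic (n m : ℝ) (φ : ℝ → ℝ) (u : sobolev 1) : Prop :=
  ∀ v : ℝ → ℝ, ContDiff ℝ ∞ v → HasCompactSupport v →
    ∫ z, (φ z ^ n * D u 1 z * deriv v z + φ z ^ m * D u 0 z * v z) =
      ∫ z, φ z ^ n * deriv v z

/-- `φ(·,t) = 1 + p(t)` is a global solution, in `C¹([0,∞); H^k)`, of the magma equation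
`(φᵐ - ∂_z φⁿ ∂_z)[φ⁻ᵐ φ_t] = -(φⁿ)_z`, that is, of the system
`φ_t = φᵐ u`, `-(φⁿ u_z)_z + φᵐ u = -(φⁿ)_z` with `u(t) ∈ H¹`. Positivity of `φ` is
positivity at every point of the continuous representative of `φ(·,t)`. Only the values `p t`
with `t ≥ 0` matter. -/
structure IsGlobalSolution (n m : ℝ) {k : ℕ} (p : ℝ → sobolev k) : Prop where
  contDiffOn : ContDiffOn ℝ 1 p (Ici 0)
  pos : ∀ t : ℝ, 0 ≤ t →
    ∃ φ : ℝ → ℝ, Continuous φ ∧ φ =ᵐ[volume] porosity (p t) ∧ ∀ z, 0 < φ z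
  eqn : ∀ t : ℝ, 0 ≤ t → ∃ u : sobolev 1,
    SolvesElliptic n m (porosity (p t)) u ∧
      D (derivWithin p (Ici 0) t) 0 =ᵐ[volume] fun z => porosity (p t) z ^ m * D u 0 z

end Magma

namespace Magma

open Filter Topology
open scoped NNReal ENNReal

/-- The Hilbert space `L²(ℝ)`. -/
noncomputable abbrev L2 := Lp ℝ 2 (volume : Measure ℝ)

/-- The space `L^∞(ℝ)`. -/
noncomputable abbrev Linf := Lp ℝ ⊤ (volume : Measure ℝ)

/-- The Sobolev space `H¹(ℝ)`. -/
abbrev H1 := sobolev 1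

theorem memLp_test {v : ℝ → ℝ} (hv : Continuous v) (hc : HasCompactSupport v) :
    MemLp v 2 (volume : Measure ℝ) :=
  hv.memLp_of_hasCompactSupport hc

theorem inner_eq_integral (f g : L2) : inner ℝ f g = ∫ z, f z * g z := by
  rw [L2.inner_def]
  exact integral_congr_ae (Eventually.of_forall fun z => by simp [mul_comm])

theorem inner_toLp (f : L2) {v : ℝ → ℝ} (hv : MemLp v 2 volume) :
    inner ℝ f hv.toLp = ∫ z, f z * v z := by
  rw [inner_eq_integral]
  refine integral_congr_ae ?_
  filter_upwards [hv.coeFn_toLp] with z hz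
  rw [hz]

theorem isWeakDeriv_iff {f g : L2} : IsWeakDeriv f g ↔
    ∀ (v : ℝ → ℝ) (hv : ContDiff ℝ ∞ v) (hc : HasCompactSupport v),
      inner ℝ f (memLp_test (hv.continuous_deriv (by simp)) hc.deriv).toLp =
        -inner ℝ g (memLp_test hv.continuous hc).toLp := by
  simp only [inner_toLp, IsWeakDeriv]

theorem isClosed_isWeakDeriv : IsClosed {x : L2 × L2 | IsWeakDeriv x.1 x.2} := by
  simp only [isWeakDeriv_iff, ofPred_forall]
  refine isClosed_iInter fun v => isClosed_iInter fun hv => isClosed_iInter fun hc => ?_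
  exact isClosed_eq (by fun_prop) (by fun_prop)

theorem IsWeakDeriv.unique {f g g' : L2} (h : IsWeakDeriv f g) (h' : IsWeakDeriv f g') :
    g = g' := by
  rw [← sub_eq_zero, Lp.eq_zero_iff_ae_eq_zero]
  refine ae_eq_zero_of_integral_contDiff_smul_eq_zero
    ((Lp.memLp (g - g')).locallyIntegrable (by norm_num)) fun v hv hc => ?_
  have e1 := isWeakDeriv_iff.1 h v hv hc
  have e2 := isWeakDeriv_iff.1 h' v hv hc
  have e3 := inner_toLp (g - g') (memLp_test hv.continuous hc)
  rw [inner_sub_left] at e3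
  simp only [smul_eq_mul, mul_comm (v _)]
  rw [← e3]
  linarith

/-- The weak derivative of order `j`, as a continuous linear map into `L²`. -/
noncomputable def comp {k : ℕ} (j : Fin (k + 1)) : sobolev k →L[ℝ] L2 :=
  (PiLp.proj 2 (fun _ : Fin (k + 1) => L2) j).comp (sobolev k).subtypeL

theorem D_eq_comp {k : ℕ} (w : sobolev k) (j : Fin (k + 1)) : D w j = comp j w := rfl

theorem isWeakDeriv_comp (w : H1) : IsWeakDeriv (comp 0 w) (comp 1 w) := w.2 0

/-- The element of `H¹` with given function and weak derivative. -/
noncomputable def mkH1 (f g : L2) (h : IsWeakDeriv f g) : H1 :=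
  ⟨WithLp.toLp 2 ![f, g], fun j => by fin_cases j; exact h⟩

@[simp] theorem comp_zero_mkH1 (f g : L2) (h : IsWeakDeriv f g) : comp 0 (mkH1 f g h) = f := rfl
@[simp] theorem comp_one_mkH1 (f g : L2) (h : IsWeakDeriv f g) : comp 1 (mkH1 f g h) = g := rfl

theorem H1.ext {w w' : H1} (h0 : comp 0 w = comp 0 w') (h1 : comp 1 w = comp 1 w') : w = w' := by
  apply Subtype.ext
  apply PiLp.ext
  intro j
  fin_cases j
  exacts [h0, h1]

theorem H1.ext_zero {w w' : H1} (h0 : comp 0 w = comp 0 w') : w = w' :=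
  H1.ext h0 ((isWeakDeriv_comp w).unique (h0 ▸ isWeakDeriv_comp w'))

theorem inner_H1 (w v : H1) :
    inner ℝ w v = inner ℝ (comp 0 w) (comp 0 v) + inner ℝ (comp 1 w) (comp 1 v) := by
  rw [Submodule.coe_inner, PiLp.inner_apply, Fin.sum_univ_two]
  rfl

theorem norm_sq_H1 (w : H1) : ‖w‖ ^ 2 = ‖comp 0 w‖ ^ 2 + ‖comp 1 w‖ ^ 2 := by
  simp only [← real_inner_self_eq_norm_sq, inner_H1]

theorem norm_comp_zero_le (w : H1) : ‖comp 0 w‖ ≤ ‖w‖ :=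
  (sq_le_sq₀ (norm_nonneg _) (norm_nonneg _)).1 (by rw [norm_sq_H1 w]; simp)

theorem norm_comp_one_le (w : H1) : ‖comp 1 w‖ ≤ ‖w‖ :=
  (sq_le_sq₀ (norm_nonneg _) (norm_nonneg _)).1 (by rw [norm_sq_H1 w]; simp)

theorem norm_H1_le (w : H1) : ‖w‖ ≤ ‖comp 0 w‖ + ‖comp 1 w‖ :=
  (sq_le_sq₀ (norm_nonneg _) (by positivity)).1 (by
    rw [norm_sq_H1]
    nlinarith [norm_nonneg (comp 0 w), norm_nonneg (comp 1 w)])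

instance (k : ℕ) : CompleteSpace (sobolev k) := by
  have : IsClosed (sobolev k : Set (PiLp 2 fun _ : Fin (k + 1) => L2)) := by
    change IsClosed {w : PiLp 2 fun _ : Fin (k + 1) => L2 |
      ∀ j : Fin k, IsWeakDeriv (w j.castSucc) (w j.succ)}
    rw [ofPred_forall]
    refine isClosed_iInter fun j => ?_
    exact isClosed_isWeakDeriv.preimage
      (f := fun w : PiLp 2 fun _ : Fin (k + 1) => L2 => (w j.castSucc, w j.succ)) (by fun_prop)
  exact this.completeSpace_coe

/-- A compactly supported `C¹` function as an element of `H¹`. -/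
noncomputable def ofTest (v : ℝ → ℝ) (hv : ContDiff ℝ 1 v) (hc : HasCompactSupport v) : H1 :=
  mkH1 (memLp_test hv.continuous hc).toLp
    (memLp_test (hv.continuous_deriv le_rfl) hc.deriv).toLp (by
      intro w hw hwc
      have hw' : Continuous (deriv w) := hw.continuous_deriv (by simp)
      have hv' : Continuous (deriv v) := hv.continuous_deriv le_rfl
      have e1 := (memLp_test hv.continuous hc).coeFn_toLp
      have e2 := (memLp_test hv' hc.deriv).coeFn_toLp
      have key := integral_mul_deriv_eq_deriv_mul_of_integrable (u := v) (v := w)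
        (u' := deriv v) (v' := deriv w)
        (fun x _ => (hv.differentiable (by simp) x).hasDerivAt)
        (fun x _ => (hw.differentiable (by simp) x).hasDerivAt)
        ((hv.continuous.mul hw').integrable_of_hasCompactSupport hc.mul_right)
        ((hv'.mul hw.continuous).integrable_of_hasCompactSupport hc.deriv.mul_right)
        ((hv.continuous.mul hw.continuous).integrable_of_hasCompactSupport hc.mul_right)
      refine (integral_congr_ae ?_).trans (key.trans (congrArg Neg.neg (integral_congr_ae ?_)))
      · filter_upwards [e1] with z hz
        rw [hz]
      · filter_upwards [e2] with z hz
        rw [hz])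

theorem coeFn_ofTest_zero (v : ℝ → ℝ) (hv : ContDiff ℝ 1 v) (hc : HasCompactSupport v) :
    (comp 0 (ofTest v hv hc) : ℝ → ℝ) =ᵐ[volume] v :=
  (memLp_test hv.continuous hc).coeFn_toLp

theorem coeFn_ofTest_one (v : ℝ → ℝ) (hv : ContDiff ℝ 1 v) (hc : HasCompactSupport v) :
    (comp 1 (ofTest v hv hc) : ℝ → ℝ) =ᵐ[volume] deriv v :=
  (memLp_test (hv.continuous_deriv le_rfl) hc.deriv).coeFn_toLp

theorem inner_comp_zero_ofTest (f : L2) (v : ℝ → ℝ) (hv : ContDiff ℝ 1 v)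
    (hc : HasCompactSupport v) : inner ℝ f (comp 0 (ofTest v hv hc)) = ∫ z, f z * v z :=
  inner_toLp f (memLp_test hv.continuous hc)

theorem inner_comp_one_ofTest (f : L2) (v : ℝ → ℝ) (hv : ContDiff ℝ 1 v)
    (hc : HasCompactSupport v) : inner ℝ f (comp 1 (ofTest v hv hc)) = ∫ z, f z * deriv v z :=
  inner_toLp f (memLp_test (hv.continuous_deriv le_rfl) hc.deriv)

open scoped Convolution in
/-- The equation `f' = ε f` with `ε ≠ 0` has no nonzero solution in `L²(ℝ)`. -/
theorem eq_zero_of_weak_deriv_eq_smul {f : L2} {ε : ℝ} (hε : ε ≠ 0)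
    (h : ∀ v : ℝ → ℝ, ContDiff ℝ ∞ v → HasCompactSupport v →
      ∫ z, f z * deriv v z = ε * ∫ z, f z * v z) : f = 0 := by
  rw [Lp.eq_zero_iff_ae_eq_zero]
  have hf : LocallyIntegrable f := (Lp.memLp f).locallyIntegrable (by norm_num)
  refine ae_eq_zero_of_integral_contDiff_smul_eq_zero hf fun g hg hc => ?_
  have hG : ContDiff ℝ ∞ (fun x => g (-x)) := hg.comp contDiff_neg
  have hGc : HasCompactSupport (fun x => g (-x)) :=
    hc.comp_homeomorph (Homeomorph.neg ℝ)
  set I : ℝ → ℝ := fun x => ∫ t, f t * g (t - x) with hI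
  have hT (x : ℝ) : ContDiff ℝ ∞ (fun t => g (t - x)) := hg.comp (contDiff_id.sub contDiff_const)
  have hTc (x : ℝ) : HasCompactSupport (fun t => g (t - x)) :=
    hc.comp_homeomorph (Homeomorph.subRight x)
  have hder (x : ℝ) : HasDerivAt I (-ε * I x) x := by
    have := hGc.hasDerivAt_convolution_right (ContinuousLinearMap.mul ℝ ℝ) (μ := volume) hf
      (hG.of_le (by simp)) x
    have e : (f ⋆[ContinuousLinearMap.mul ℝ ℝ, volume] fun x => g (-x)) = I := by
      funext y
      simp [convolution, hI]
    rw [e] at this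
    refine this.congr_deriv ?_
    have h1 := h _ (hT x) (hTc x)
    have h2 : ∀ t, deriv (fun t => g (t - x)) t = -deriv (fun x => g (-x)) (x - t) := by
      intro t
      rw [deriv_comp_sub_const, deriv_comp_neg]
      simp
    simp only [h2, mul_neg, integral_neg] at h1
    change ∫ t, f t * deriv (fun x => g (-x)) (x - t) = -ε * I x
    change -∫ t, f t * deriv (fun x => g (-x)) (x - t) = ε * I x at h1
    linarith
  have hbd (x : ℝ) : |I x| ≤ ‖f‖ * ‖(memLp_test hg.continuous hc).toLp‖ := by
    have e := inner_toLp f (memLp_test (hT x).continuous (hTc x))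
    change |∫ t, f t * g (t - x)| ≤ _
    rw [← e]
    refine (abs_real_inner_le_norm _ _).trans_eq ?_
    congr 1
    rw [Lp.norm_toLp, Lp.norm_toLp]
    congr 1
    exact eLpNorm_comp_measurePreserving hg.continuous.aestronglyMeasurable
      (measurePreserving_sub_right volume x)
  have hconst (x : ℝ) : I x * Real.exp (ε * x) = I 0 := by
    have hd (x : ℝ) : HasDerivAt (fun x => I x * Real.exp (ε * x)) 0 x := by
      have := (hder x).mul (((hasDerivAt_id x).const_mul ε).exp)
      refine this.congr_deriv ?_
      simp only [id, mul_one]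
      ring
    have := is_const_of_deriv_eq_zero (fun x => (hd x).differentiableAt) (fun x => (hd x).deriv) x 0
    simpa using this
  have hlim : Tendsto (fun s : ℝ => ‖f‖ * ‖(memLp_test hg.continuous hc).toLp‖ * Real.exp (-s))
      atTop (𝓝 0) := by
    simpa using (Real.tendsto_exp_neg_atTop_nhds_zero).const_mul
      (‖f‖ * ‖(memLp_test hg.continuous hc).toLp‖)
  have hzero : |I 0| ≤ 0 := by
    refine ge_of_tendsto' hlim fun s => ?_
    rw [← hconst (-s / ε), abs_mul, Real.abs_exp]
    have : ε * (-s / ε) = -s := by field_simp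
    rw [this]
    exact mul_le_mul_of_nonneg_right (hbd _) (Real.exp_pos _).le
  have : I 0 = 0 := abs_nonpos_iff.1 hzero
  simpa [hI, mul_comm] using this

/-- Smooth compactly supported functions are dense in `H¹`. -/
theorem dense_ofTest : Dense {w : H1 | ∃ (v : ℝ → ℝ) (hv : ContDiff ℝ ∞ v)
    (hc : HasCompactSupport v), w = ofTest v (hv.of_le (by simp)) hc} := by
  let K : Submodule ℝ H1 :=
    { carrier := {w : H1 | ∃ (v : ℝ → ℝ) (hv : ContDiff ℝ ∞ v)
        (hc : HasCompactSupport v), w = ofTest v (hv.of_le (by simp)) hc}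
      add_mem' := by
        rintro _ _ ⟨v, hv, hc, rfl⟩ ⟨v', hv', hc', rfl⟩
        exact ⟨v + v', hv.add hv', hc.add hc', H1.ext_zero (MemLp.toLp_add
          (memLp_test hv.continuous hc) (memLp_test hv'.continuous hc')).symm⟩
      zero_mem' := ⟨0, contDiff_const, HasCompactSupport.zero, H1.ext_zero (MemLp.toLp_zero
        (memLp_test continuous_const HasCompactSupport.zero)).symm⟩
      smul_mem' := by
        rintro c _ ⟨v, hv, hc, rfl⟩
        exact ⟨c • v, hv.const_smul c, hc.smul_left (f := fun _ => c),
          H1.ext_zero (MemLp.toLp_const_smul c (memLp_test hv.continuous hc)).symm⟩ }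
  change Dense (K : Set H1)
  rw [Submodule.dense_iff_topologicalClosure_eq_top, Submodule.topologicalClosure_eq_top_iff,
    Submodule.eq_bot_iff]
  intro h hh
  have hp (v : ℝ → ℝ) (hv : ContDiff ℝ ∞ v) (hc : HasCompactSupport v) :
      (∫ z, comp 0 h z * v z) + ∫ z, comp 1 h z * deriv v z = 0 := by
    have := (Submodule.mem_orthogonal' _ _).1 hh _ ⟨v, hv, hc, rfl⟩
    rwa [inner_H1, inner_comp_zero_ofTest, inner_comp_one_ofTest] at this
  have hw := isWeakDeriv_comp h
  have lin (ε : ℝ) (v : ℝ → ℝ) (hv : Continuous v) (hc : HasCompactSupport v) :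
      ∫ z, (comp 0 h + ε • comp 1 h : L2) z * v z =
        (∫ z, comp 0 h z * v z) + ε * ∫ z, comp 1 h z * v z := by
    simp only [← inner_toLp _ (memLp_test hv hc), inner_add_left, real_inner_smul_left]
  have key (ε : ℝ) (hε : ε ^ 2 = 1) : comp 0 h + ε • comp 1 h = 0 := by
    refine eq_zero_of_weak_deriv_eq_smul (ε := -ε) (by rintro h0; simp_all) fun v hv hc => ?_
    rw [lin ε v hv.continuous hc, lin ε _ (hv.continuous_deriv (by simp)) hc.deriv, hw v hv hc]
    have := hp v hv hc
    linear_combination ε * this + (∫ z, comp 1 h z * v z) * hε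
  have h1 := key 1 (by norm_num)
  have h2 := key (-1) (by norm_num)
  rw [one_smul] at h1
  rw [neg_smul, one_smul] at h2
  have h0 : (2 : ℝ) • comp 0 h = 0 := by
    rw [two_smul]
    calc comp 0 h + comp 0 h = (comp 0 h + comp 1 h) + (comp 0 h + -comp 1 h) := by abel
      _ = 0 := by rw [h1, h2, add_zero]
  exact H1.ext_zero (by simpa using h0)

theorem abs_le_norm_ofTest (v : ℝ → ℝ) (hv : ContDiff ℝ 1 v) (hc : HasCompactSupport v) (x : ℝ) :
    |v x| ≤ ‖ofTest v hv hc‖ := by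
  refine abs_le_of_sq_le_sq ?_ (norm_nonneg _)
  have hv' : Continuous (deriv v) := hv.continuous_deriv le_rfl
  have h0 : ‖comp 0 (ofTest v hv hc)‖ ^ 2 = ∫ z, v z * v z := by
    rw [← real_inner_self_eq_norm_sq, inner_comp_zero_ofTest]
    refine integral_congr_ae ?_
    filter_upwards [coeFn_ofTest_zero v hv hc] with z hz
    rw [hz]
  have h1 : ‖comp 1 (ofTest v hv hc)‖ ^ 2 = ∫ z, deriv v z * deriv v z := by
    rw [← real_inner_self_eq_norm_sq, inner_comp_one_ofTest]
    refine integral_congr_ae ?_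
    filter_upwards [coeFn_ofTest_one v hv hc] with z hz
    rw [hz]
  have i0 : Integrable (fun z => v z * v z) :=
    (hv.continuous.mul hv.continuous).integrable_of_hasCompactSupport hc.mul_right
  have i1 : Integrable (fun z => deriv v z * deriv v z) :=
    (hv'.mul hv').integrable_of_hasCompactSupport hc.deriv.mul_right
  have i2 : Integrable (fun z => deriv v z * v z + v z * deriv v z) :=
    ((hv'.mul hv.continuous).add (hv.continuous.mul hv')).integrable_of_hasCompactSupport
      (hc.mul_left.add hc.mul_right)
  have key := HasCompactSupport.integral_Iic_deriv_eq (hv.mul hv) (hc.mul_right (f' := v)) x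
  have hd (z : ℝ) : deriv (fun z => v z * v z) z = deriv v z * v z + v z * deriv v z :=
    deriv_fun_mul (hv.differentiable (by simp) z) (hv.differentiable (by simp) z)
  rw [norm_sq_H1, h0, h1, ← integral_add i0 i1, sq]
  refine key.symm.le.trans ?_
  refine (setIntegral_congr_fun measurableSet_Iic fun z _ => hd z).le.trans ?_
  refine (setIntegral_mono i2.integrableOn (i0.add i1).integrableOn fun z => ?_).trans
    (setIntegral_le_integral (i0.add i1) (Eventually.of_forall fun z => ?_))
  · simp only [Pi.add_apply]
    nlinarith [sq_nonneg (v z - deriv v z)]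
  · exact add_nonneg (mul_self_nonneg _) (mul_self_nonneg _)

/-- Sobolev embedding: an `H¹` function has a continuous representative, bounded by its norm. -/
theorem exists_continuous_rep (w : H1) : ∃ φ : ℝ → ℝ, Continuous φ ∧
    φ =ᵐ[volume] comp 0 w ∧ ∀ z, |φ z| ≤ ‖w‖ := by
  obtain ⟨s, hs, hlim⟩ := mem_closure_iff_seq_limit.1 (dense_ofTest w)
  choose v hv hc hvs using hs
  have hv1 (n : ℕ) : ContDiff ℝ 1 (v n) := (hv n).of_le (by simp)
  let b (n : ℕ) : BoundedContinuousFunction ℝ ℝ :=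
    BoundedContinuousFunction.ofNormedAddCommGroup (v n) (hv1 n).continuous ‖s n‖ fun x => by
      have h := abs_le_norm_ofTest (v n) (hv1 n) (hc n) x
      rwa [← hvs n] at h
  have hdist (n m : ℕ) : dist (b n) (b m) ≤ dist (s n) (s m) := by
    refine (BoundedContinuousFunction.dist_le dist_nonneg).2 fun x => ?_
    have hsub : HasCompactSupport (v n - v m) := (hc n).sub (hc m)
    have e : s n - s m = ofTest (v n - v m) ((hv1 n).sub (hv1 m)) hsub := by
      rw [hvs n, hvs m]
      exact H1.ext_zero (MemLp.toLp_sub (memLp_test (hv1 n).continuous (hc n))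
        (memLp_test (hv1 m).continuous (hc m))).symm
    rw [dist_eq_norm (s n), e]
    exact abs_le_norm_ofTest (v n - v m) ((hv1 n).sub (hv1 m)) hsub x
  have hcau : CauchySeq b := by
    have h := hlim.cauchySeq
    rw [Metric.cauchySeq_iff] at h ⊢
    intro ε hε
    obtain ⟨N, hN⟩ := h ε hε
    exact ⟨N, fun m hm n hn => (hdist m n).trans_lt (hN m hm n hn)⟩
  obtain ⟨φ, hφ⟩ := cauchySeq_tendsto_of_complete hcau
  have hpt (x : ℝ) : Tendsto (fun n => v n x) atTop (𝓝 (φ x)) :=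
    (BoundedContinuousFunction.tendsto_iff_tendstoUniformly.1 hφ).tendsto_at x
  refine ⟨φ, φ.continuous, ?_, fun z => ?_⟩
  · have h0 : Tendsto (fun n => comp 0 (s n)) atTop (𝓝 (comp 0 w)) :=
      ((comp 0).continuous.tendsto w).comp hlim
    obtain ⟨ns, hns, hae⟩ := (tendstoInMeasure_of_tendsto_Lp h0).exists_seq_tendsto_ae
    have hall : ∀ᵐ z, ∀ n, comp 0 (s n) z = v n z := by
      rw [ae_all_iff]
      intro n
      filter_upwards [coeFn_ofTest_zero (v n) (hv1 n) (hc n)] with z hz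
      rw [hvs n, hz]
    filter_upwards [hae, hall] with z h1 h2
    refine tendsto_nhds_unique ?_ h1
    simp only [h2]
    exact (hpt z).comp hns.tendsto_atTop
  · refine le_of_tendsto_of_tendsto' (hpt z).abs hlim.norm fun n => ?_
    have h := abs_le_norm_ofTest (v n) (hv1 n) (hc n) z
    rwa [← hvs n] at h

theorem ae_abs_le_norm (w : H1) : ∀ᵐ z, |comp 0 w z| ≤ ‖w‖ := by
  obtain ⟨φ, -, h, hb⟩ := exists_continuous_rep w
  filter_upwards [h] with z hz
  rw [← hz]
  exact hb z

theorem memLp_top_comp_zero (w : H1) : MemLp (comp 0 w) ⊤ (volume : Measure ℝ) :=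
  memLp_top_of_bound (Lp.aestronglyMeasurable _) ‖w‖ (ae_abs_le_norm w)

theorem Linf_norm_le (a : Linf) {C : ℝ} (hC : 0 ≤ C) (h : ∀ᵐ z, |a z| ≤ C) : ‖a‖ ≤ C := by
  rw [Lp.norm_def]
  refine ENNReal.toReal_le_of_le_ofReal hC ?_
  exact (eLpNorm_le_of_ae_bound (C := C) h).trans (by simp)

/-- The embedding of `H¹(ℝ)` into `L^∞(ℝ)`. -/
noncomputable def toLinf : H1 →L[ℝ] Linf :=
  LinearMap.mkContinuous
    { toFun := fun w => (memLp_top_comp_zero w).toLp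
      map_add' := fun w w' => by
        rw [← MemLp.toLp_add]
        refine MemLp.toLp_congr _ _ ?_
        rw [map_add]
        exact Lp.coeFn_add _ _
      map_smul' := fun c w => by
        rw [RingHom.id_apply, ← MemLp.toLp_const_smul]
        refine MemLp.toLp_congr _ _ ?_
        rw [map_smul]
        exact Lp.coeFn_smul _ _ }
    1 fun w => by
      rw [one_mul]
      refine Linf_norm_le _ (norm_nonneg _) ?_
      filter_upwards [(memLp_top_comp_zero w).coeFn_toLp, ae_abs_le_norm w] with z h1 h2
      exact (congrArg abs h1).trans_le h2

theorem coeFn_toLinf (w : H1) : toLinf w =ᵐ[volume] comp 0 w :=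
  (memLp_top_comp_zero w).coeFn_toLp

theorem norm_toLinf_le (w : H1) : ‖toLinf w‖ ≤ ‖w‖ := by
  simpa using (LinearMap.mkContinuous_norm_le _ zero_le_one _ : ‖toLinf‖ ≤ 1) |>
    toLinf.le_of_opNorm_le (x := w)

/-- Multiplication `L^∞ × L² → L²`. -/
noncomputable def mulL : Linf →L[ℝ] L2 →L[ℝ] L2 :=
  (ContinuousLinearMap.mul ℝ ℝ).holderL volume ⊤ 2 2

theorem coeFn_mulL (a : Linf) (f : L2) : mulL a f =ᵐ[volume] fun z => a z * f z :=
  (ContinuousLinearMap.mul ℝ ℝ).coeFn_holder (r := 2) a f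

theorem norm_mulL_le (a : Linf) (f : L2) : ‖mulL a f‖ ≤ ‖a‖ * ‖f‖ := by
  have := (ContinuousLinearMap.mul ℝ ℝ).norm_holder_apply_apply_le (r := 2) a f
  rwa [ContinuousLinearMap.opNorm_mul, one_mul] at this

/-- A continuous map into `L² × L²` that sends test functions to functions with their weak
derivatives sends all of `H¹` to such pairs. -/
theorem isWeakDeriv_of_test {F G : H1 → L2} (hF : Continuous F) (hG : Continuous G)
    (h : ∀ (v : ℝ → ℝ) (hv : ContDiff ℝ ∞ v) (hc : HasCompactSupport v),
      IsWeakDeriv (F (ofTest v (hv.of_le (by simp)) hc)) (G (ofTest v (hv.of_le (by simp)) hc)))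
    (w : H1) : IsWeakDeriv (F w) (G w) := by
  have hcl : IsClosed {w : H1 | IsWeakDeriv (F w) (G w)} :=
    isClosed_isWeakDeriv.preimage (f := fun w => (F w, G w)) (by fun_prop)
  refine hcl.closure_subset_iff.2 ?_ (dense_ofTest w)
  rintro _ ⟨v, hv, hc, rfl⟩
  exact h v hv hc

theorem isWeakDeriv_of_contDiff {f g : L2} {v : ℝ → ℝ} (hv : ContDiff ℝ 1 v)
    (hc : HasCompactSupport v) (hf : f =ᵐ[volume] v) (hg : g =ᵐ[volume] deriv v) :
    IsWeakDeriv f g := by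
  have e0 : f = comp 0 (ofTest v hv hc) := Lp.ext (hf.trans (coeFn_ofTest_zero v hv hc).symm)
  have e1 : g = comp 1 (ofTest v hv hc) := Lp.ext (hg.trans (coeFn_ofTest_one v hv hc).symm)
  rw [e0, e1]
  exact isWeakDeriv_comp _

theorem isWeakDeriv_mul (w v : H1) : IsWeakDeriv (mulL (toLinf w) (comp 0 v))
    (mulL (toLinf w) (comp 1 v) + mulL (toLinf v) (comp 1 w)) := by
  refine isWeakDeriv_of_test (F := fun v => mulL (toLinf w) (comp 0 v))
    (G := fun v => mulL (toLinf w) (comp 1 v) + mulL (toLinf v) (comp 1 w))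
    (by fun_prop) (by fun_prop) (fun g hg hgc => ?_) v
  set v' := ofTest g (hg.of_le (by simp)) hgc
  refine isWeakDeriv_of_test (F := fun w => mulL (toLinf w) (comp 0 v'))
    (G := fun w => mulL (toLinf w) (comp 1 v') + mulL (toLinf v') (comp 1 w))
    (by fun_prop) (by fun_prop) (fun f hf hfc => ?_) w
  have hf1 : ContDiff ℝ 1 f := hf.of_le (by simp)
  have hg1 : ContDiff ℝ 1 g := hg.of_le (by simp)
  set w' := ofTest f (hf.of_le (by simp)) hfc
  refine isWeakDeriv_of_contDiff (hf1.mul hg1) hfc.mul_right ?_ ?_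
  · filter_upwards [coeFn_mulL (toLinf w') (comp 0 v'), coeFn_toLinf w',
      coeFn_ofTest_zero f hf1 hfc, coeFn_ofTest_zero g hg1 hgc] with z h1 h2 h3 h4
    rw [h1, h2, h3, h4]
  · filter_upwards [Lp.coeFn_add (mulL (toLinf w') (comp 1 v')) (mulL (toLinf v') (comp 1 w')),
      coeFn_mulL (toLinf w') (comp 1 v'), coeFn_mulL (toLinf v') (comp 1 w'), coeFn_toLinf w',
      coeFn_toLinf v', coeFn_ofTest_zero f hf1 hfc, coeFn_ofTest_zero g hg1 hgc,
      coeFn_ofTest_one f hf1 hfc, coeFn_ofTest_one g hg1 hgc] with z h1 h2 h3 h4 h5 h6 h7 h8 h9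
    rw [h1, Pi.add_apply, h2, h3, h4, h5, h6, h7, h8, h9]
    have := deriv_fun_mul (hf1.differentiable (by simp) z) (hg1.differentiable (by simp) z)
    refine Eq.trans ?_ this.symm
    ring

/-- Multiplication in the algebra `H¹(ℝ)`. -/
noncomputable def mulH1 : H1 →L[ℝ] H1 →L[ℝ] H1 :=
  LinearMap.mkContinuous₂
    (LinearMap.mk₂ ℝ (fun w v => mkH1 _ _ (isWeakDeriv_mul w v))
      (fun w w' v => H1.ext_zero (by simp))
      (fun c w v => H1.ext_zero (by simp))
      (fun w v v' => H1.ext_zero (by simp))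
      (fun c w v => H1.ext_zero (by simp)))
    3 fun w v => by
      refine (norm_H1_le _).trans ?_
      have h1 : ‖mulL (toLinf w) (comp 0 v)‖ ≤ ‖w‖ * ‖v‖ :=
        (norm_mulL_le _ _).trans (by gcongr; exacts [norm_toLinf_le w, norm_comp_zero_le v])
      have h2 : ‖mulL (toLinf w) (comp 1 v)‖ ≤ ‖w‖ * ‖v‖ :=
        (norm_mulL_le _ _).trans (by gcongr; exacts [norm_toLinf_le w, norm_comp_one_le v])
      have h3 : ‖mulL (toLinf v) (comp 1 w)‖ ≤ ‖v‖ * ‖w‖ :=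
        (norm_mulL_le _ _).trans (by gcongr; exacts [norm_toLinf_le v, norm_comp_one_le w])
      have h4 := norm_add_le (mulL (toLinf w) (comp 1 v)) (mulL (toLinf v) (comp 1 w))
      simp only [LinearMap.mk₂_apply, comp_zero_mkH1, comp_one_mkH1]
      linarith [mul_comm ‖v‖ ‖w‖]

theorem comp_zero_mulH1 (w v : H1) : comp 0 (mulH1 w v) = mulL (toLinf w) (comp 0 v) := rfl

theorem comp_one_mulH1 (w v : H1) :
    comp 1 (mulH1 w v) = mulL (toLinf w) (comp 1 v) + mulL (toLinf v) (comp 1 w) := rfl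

theorem coeFn_mulH1 (w v : H1) :
    comp 0 (mulH1 w v) =ᵐ[volume] fun z => comp 0 w z * comp 0 v z := by
  filter_upwards [coeFn_mulL (toLinf w) (comp 0 v), coeFn_toLinf w] with z h1 h2
  rw [comp_zero_mulH1, h1, h2]

/-- A smooth function vanishing at `0` all of whose derivatives of positive order are bounded. -/
structure BddDeriv (f : ℝ → ℝ) : Prop where
  contDiff : ContDiff ℝ ∞ f
  zero : f 0 = 0
  bdd : ∀ k : ℕ, ∃ C : ℝ, ∀ x, |iteratedDeriv (k + 1) f x| ≤ C

namespace BddDeriv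

variable {f : ℝ → ℝ}

theorem exists_lipschitzWith (hf : BddDeriv f) : ∃ C : ℝ≥0, LipschitzWith C f := by
  obtain ⟨C, hC⟩ := hf.bdd 0
  refine ⟨C.toNNReal, lipschitzWith_of_nnnorm_deriv_le (hf.contDiff.differentiable (by simp))
    fun x => ?_⟩
  rw [← NNReal.coe_le_coe, coe_nnnorm, Real.norm_eq_abs]
  have := hC x
  rw [zero_add, iteratedDeriv_one] at this
  exact this.trans (Real.le_coe_toNNReal C)

/-- A Lipschitz constant. -/
noncomputable def lip (hf : BddDeriv f) : ℝ≥0 := hf.exists_lipschitzWith.choose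

theorem lipschitzWith (hf : BddDeriv f) : LipschitzWith hf.lip f :=
  hf.exists_lipschitzWith.choose_spec

theorem differentiable (hf : BddDeriv f) : Differentiable ℝ f :=
  hf.contDiff.differentiable (by simp)

theorem deriv_sub (hf : BddDeriv f) : BddDeriv (fun x => deriv f x - deriv f 0) where
  contDiff := ((contDiff_infty_iff_deriv.1 hf.contDiff).2).sub contDiff_const
  zero := sub_self _
  bdd k := by
    obtain ⟨C, hC⟩ := hf.bdd (k + 1)
    refine ⟨C, fun x => ?_⟩
    have := hC x
    rw [iteratedDeriv_succ'] at this ⊢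
    rw [iteratedDeriv_succ'] at this
    have e : deriv (fun x => deriv f x - deriv f 0) = deriv (deriv f) := by
      funext x
      rw [deriv_sub_const]
    rwa [e]

theorem abs_deriv_sub_le (hf : BddDeriv f) (x y : ℝ) :
    |deriv f x - deriv f y| ≤ hf.deriv_sub.lip * |x - y| := by
  have := hf.deriv_sub.lipschitzWith.dist_le_mul x y
  rwa [Real.dist_eq, Real.dist_eq, sub_sub_sub_cancel_right] at this

end BddDeriv

theorem abs_taylor_le {f : ℝ → ℝ} {C : ℝ} (hC : 0 ≤ C) (hf : Differentiable ℝ f)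
    (h : ∀ x y, |deriv f x - deriv f y| ≤ C * |x - y|) (x y : ℝ) :
    |f (x + y) - f x - deriv f x * y| ≤ C * |y| ^ 2 := by
  have hd (t : ℝ) : HasDerivAt (fun t => f t - deriv f x * t) (deriv f t - deriv f x) t := by
    have := (hf t).hasDerivAt.sub ((hasDerivAt_id t).const_mul (deriv f x))
    rwa [mul_one] at this
  have := (convex_uIcc x (x + y)).norm_image_sub_le_of_norm_hasDerivWithin_le (C := C * |y|)
    (fun t _ => (hd t).hasDerivWithinAt) (fun t ht => ?_) left_mem_uIcc right_mem_uIcc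
  · rw [Real.norm_eq_abs, Real.norm_eq_abs, add_sub_cancel_left] at this
    calc _ = |f (x + y) - deriv f x * (x + y) - (f x - deriv f x * x)| := by congr 1; ring
      _ ≤ _ := this
      _ = _ := by ring
  · refine (h t x).trans (mul_le_mul_of_nonneg_left ?_ hC)
    have := abs_sub_left_of_mem_uIcc ht
    simpa using this

theorem hasFDerivAt_of_quadratic {E F : Type*} [NormedAddCommGroup E] [NormedSpace ℝ E]
    [NormedAddCommGroup F] [NormedSpace ℝ F] {f : E → F} {f' : E →L[ℝ] F} {x : E} (C : ℝ)
    (h : ∀ v, ‖v‖ ≤ 1 → ‖f (x + v) - f x - f' v‖ ≤ C * ‖v‖ ^ 2) : HasFDerivAt f f' x := by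
  rw [hasFDerivAt_iff_isLittleO_nhds_zero]
  refine Asymptotics.IsBigO.trans_isLittleO (g := fun v : E => ‖v‖ ^ 2) ?_
    (Asymptotics.isLittleO_norm_pow_id one_lt_two)
  refine Asymptotics.IsBigO.of_bound C ?_
  filter_upwards [Metric.closedBall_mem_nhds (0 : E) one_pos] with v hv
  rw [Real.norm_of_nonneg (by positivity)]
  exact h v (by simpa using hv)

theorem norm_le_of_ae_le_add {f g h : L2} {a b : ℝ}
    (H : ∀ᵐ z, |f z| ≤ a * |g z| + b * |h z|) (ha : 0 ≤ a) (hb : 0 ≤ b) :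
    ‖f‖ ≤ a * ‖g‖ + b * ‖h‖ := by
  have e : ‖f‖ ≤ ‖a • |g| + b • |h|‖ := by
    refine Lp.norm_le_norm_of_ae_le ?_
    filter_upwards [H, Lp.coeFn_add (a • |g|) (b • |h|), Lp.coeFn_smul a |g|, Lp.coeFn_smul b |h|,
      Lp.coeFn_abs g, Lp.coeFn_abs h] with z h0 h1 h2 h3 h4 h5
    rw [h1, Pi.add_apply, h2, h3, Pi.smul_apply, Pi.smul_apply, h4, h5]
    exact h0.trans (le_abs_self _)
  refine e.trans ((norm_add_le _ _).trans ?_)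
  rw [norm_smul, norm_smul, norm_abs_eq_norm, norm_abs_eq_norm, Real.norm_of_nonneg ha,
    Real.norm_of_nonneg hb]

/-- Maps that are Lipschitz on every ball. -/
def LipBall {E F : Type*} [NormedAddCommGroup E] [NormedAddCommGroup F] (G : E → F) : Prop :=
  ∀ R : ℝ, ∃ K : ℝ≥0, LipschitzOnWith K G (Metric.closedBall 0 R)

namespace LipBall

variable {E F F' F'' : Type*} [NormedAddCommGroup E] [NormedAddCommGroup F]
  [NormedAddCommGroup F'] [NormedAddCommGroup F'']

theorem of_bound {G : E → F} (h : ∀ R : ℝ, 0 ≤ R → ∃ K : ℝ, ∀ x y, ‖x‖ ≤ R → ‖y‖ ≤ R →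
    ‖G x - G y‖ ≤ K * ‖x - y‖) : LipBall G := by
  intro R
  obtain ⟨K, hK⟩ := h |R| (abs_nonneg R)
  refine ⟨K.toNNReal, LipschitzOnWith.of_dist_le_mul fun x hx y hy => ?_⟩
  rw [dist_eq_norm, dist_eq_norm]
  rw [mem_closedBall_zero_iff] at hx hy
  exact (hK x y (hx.trans (le_abs_self R)) (hy.trans (le_abs_self R))).trans
    (mul_le_mul_of_nonneg_right (Real.le_coe_toNNReal K) (norm_nonneg _))

theorem exists_bound {G : E → F} (hG : LipBall G) (R : ℝ) : ∃ K M : ℝ, 0 ≤ K ∧ 0 ≤ M ∧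
    (∀ x y, ‖x‖ ≤ R → ‖y‖ ≤ R → ‖G x - G y‖ ≤ K * ‖x - y‖) ∧ ∀ x, ‖x‖ ≤ R → ‖G x‖ ≤ M := by
  obtain ⟨K, hK⟩ := hG R
  have h (x y : E) (hx : ‖x‖ ≤ R) (hy : ‖y‖ ≤ R) : ‖G x - G y‖ ≤ K * ‖x - y‖ := by
    simpa only [dist_eq_norm] using
      hK.dist_le_mul x (mem_closedBall_zero_iff.2 hx) y (mem_closedBall_zero_iff.2 hy)
  refine ⟨K, ‖G 0‖ + K * |R|, K.2, by positivity, h, fun x hx => ?_⟩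
  have h0 : ‖(0 : E)‖ ≤ R := by simpa using (norm_nonneg x).trans hx
  have h1 := h x 0 hx h0
  rw [sub_zero] at h1
  have h2 : (K : ℝ) * ‖x‖ ≤ K * |R| := by
    gcongr
    exact hx.trans (le_abs_self R)
  linarith [norm_sub_norm_le (G x) (G 0)]

theorem continuous {G : E → F} (hG : LipBall G) : Continuous G := by
  rw [continuous_iff_continuousAt]
  intro x
  obtain ⟨K, hK⟩ := hG (‖x‖ + 1)
  refine hK.continuousOn.continuousAt (Filter.mem_of_superset (Metric.ball_mem_nhds x one_pos) ?_)
  intro y hy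
  rw [mem_closedBall_zero_iff]
  rw [mem_ball_iff_norm] at hy
  linarith [norm_sub_norm_le y x]

theorem add {G H : E → F} (hG : LipBall G) (hH : LipBall H) : LipBall (fun x => G x + H x) := by
  intro R
  obtain ⟨K, hK⟩ := hG R
  obtain ⟨K', hK'⟩ := hH R
  exact ⟨_, hK.add hK'⟩

theorem sub {G H : E → F} (hG : LipBall G) (hH : LipBall H) : LipBall (fun x => G x - H x) := by
  intro R
  obtain ⟨K, hK⟩ := hG R
  obtain ⟨K', hK'⟩ := hH R
  exact ⟨_, hK.sub hK'⟩

theorem lipschitz_comp {G : E → F} {L : F → F'} {K : ℝ≥0} (hL : LipschitzWith K L)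
    (hG : LipBall G) : LipBall (fun x => L (G x)) := by
  intro R
  obtain ⟨K', hK'⟩ := hG R
  exact ⟨_, hL.comp_lipschitzOnWith hK'⟩

variable [NormedSpace ℝ F] [NormedSpace ℝ F'] [NormedSpace ℝ F'']

theorem clm [NormedSpace ℝ E] (L : E →L[ℝ] F) : LipBall L := fun _ => ⟨_, L.lipschitz.lipschitzOnWith⟩

theorem clm_comp {G : E → F} (L : F →L[ℝ] F') (hG : LipBall G) : LipBall (fun x => L (G x)) :=
  lipschitz_comp L.lipschitz hG

theorem bilin {G : E → F} {H : E → F'} (B : F →L[ℝ] F' →L[ℝ] F'') (hG : LipBall G)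
    (hH : LipBall H) : LipBall (fun x => B (G x) (H x)) := by
  refine of_bound fun R _ => ?_
  obtain ⟨K, M, hK0, hM0, hK, hM⟩ := hG.exists_bound R
  obtain ⟨K', M', hK'0, hM'0, hK', hM'⟩ := hH.exists_bound R
  refine ⟨‖B‖ * (M * K' + K * M'), fun x y hx hy => ?_⟩
  have e : B (G x) (H x) - B (G y) (H y) = B (G x) (H x - H y) + B (G x - G y) (H y) := by
    simp
  rw [e]
  refine (norm_add_le _ _).trans ?_
  have h1 := (B.le_opNorm₂ (G x) (H x - H y)).trans
    (mul_le_mul (mul_le_mul_of_nonneg_left (hM x hx) (norm_nonneg B)) (hK' x y hx hy)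
      (norm_nonneg _) (by positivity))
  have h2 := (B.le_opNorm₂ (G x - G y) (H y)).trans
    (mul_le_mul (mul_le_mul_of_nonneg_left (hK x y hx hy) (norm_nonneg B)) (hM' y hy)
      (norm_nonneg _) (by positivity))
  refine (add_le_add h1 h2).trans_eq ?_
  ring

end LipBall

theorem LipBall.of_comp {E : Type*} [NormedAddCommGroup E] {G : E → H1}
    (h0 : LipBall fun x => comp 0 (G x)) (h1 : LipBall fun x => comp 1 (G x)) : LipBall G := by
  refine LipBall.of_bound fun R _ => ?_
  obtain ⟨K, -, -, -, hK, -⟩ := h0.exists_bound R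
  obtain ⟨K', -, -, -, hK', -⟩ := h1.exists_bound R
  refine ⟨K + K', fun x y hx hy => ?_⟩
  have := norm_H1_le (G x - G y)
  rw [map_sub, map_sub] at this
  linarith [hK x y hx hy, hK' x y hx hy]

section Nemytskii

variable {f : ℝ → ℝ}

/-- Composition with `f` on `L^∞`. -/
noncomputable def compLinf (hf : BddDeriv f) (a : Linf) : Linf := hf.lipschitzWith.compLp hf.zero a

/-- Composition with `f` on `L²`. -/
noncomputable def compL2 (hf : BddDeriv f) (a : L2) : L2 := hf.lipschitzWith.compLp hf.zero a

theorem coeFn_compLinf (hf : BddDeriv f) (a : Linf) :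
    compLinf hf a =ᵐ[volume] fun z => f (a z) := hf.lipschitzWith.coeFn_compLp hf.zero a

theorem coeFn_compL2 (hf : BddDeriv f) (a : L2) :
    compL2 hf a =ᵐ[volume] fun z => f (a z) := hf.lipschitzWith.coeFn_compLp hf.zero a

theorem lipschitzWith_compLinf (hf : BddDeriv f) : LipschitzWith hf.lip (compLinf hf) :=
  hf.lipschitzWith.lipschitzWith_compLp hf.zero

theorem lipschitzWith_compL2 (hf : BddDeriv f) : LipschitzWith hf.lip (compL2 hf) :=
  hf.lipschitzWith.lipschitzWith_compLp hf.zero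

/-- The weak derivative `f'(w) ∂_z w` of `f ∘ w`. -/
noncomputable def nemDeriv (hf : BddDeriv f) (w : H1) : L2 :=
  deriv f 0 • comp 1 w + mulL (compLinf hf.deriv_sub (toLinf w)) (comp 1 w)

theorem coeFn_nemDeriv (hf : BddDeriv f) (w : H1) :
    nemDeriv hf w =ᵐ[volume] fun z => deriv f (comp 0 w z) * comp 1 w z := by
  filter_upwards [Lp.coeFn_add (deriv f 0 • comp 1 w)
      (mulL (compLinf hf.deriv_sub (toLinf w)) (comp 1 w)), Lp.coeFn_smul (deriv f 0) (comp 1 w),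
    coeFn_mulL (compLinf hf.deriv_sub (toLinf w)) (comp 1 w),
    coeFn_compLinf hf.deriv_sub (toLinf w), coeFn_toLinf w] with z h1 h2 h3 h4 h5
  rw [nemDeriv, h1, Pi.add_apply, h2, h3, h4, h5, Pi.smul_apply, smul_eq_mul]
  ring

theorem lipBall_nemDeriv (hf : BddDeriv f) : LipBall (nemDeriv hf) :=
  (LipBall.clm (deriv f 0 • comp 1)).add
    (LipBall.bilin mulL (LipBall.lipschitz_comp (lipschitzWith_compLinf hf.deriv_sub)
      (LipBall.clm toLinf)) (LipBall.clm (comp 1)))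

theorem isWeakDeriv_nem (hf : BddDeriv f) (w : H1) :
    IsWeakDeriv (compL2 hf (comp 0 w)) (nemDeriv hf w) := by
  refine isWeakDeriv_of_test (F := fun w => compL2 hf (comp 0 w)) (G := nemDeriv hf)
    ((lipschitzWith_compL2 hf).continuous.comp (comp 0).continuous)
    (lipBall_nemDeriv hf).continuous (fun v hv hc => ?_) w
  have hv1 : ContDiff ℝ 1 v := hv.of_le (by simp)
  refine isWeakDeriv_of_contDiff (v := f ∘ v) ((hf.contDiff.of_le (by simp)).comp hv1)
    (hc.comp_left hf.zero) ?_ ?_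
  · filter_upwards [coeFn_compL2 hf (comp 0 (ofTest v hv1 hc)), coeFn_ofTest_zero v hv1 hc]
      with z h1 h2
    rw [h1, h2, Function.comp_apply]
  · filter_upwards [coeFn_nemDeriv hf (ofTest v hv1 hc), coeFn_ofTest_zero v hv1 hc,
      coeFn_ofTest_one v hv1 hc] with z h1 h2 h3
    rw [h1, h2, h3, deriv_comp _ (hf.differentiable _) (hv1.differentiable (by simp) z)]

/-- The Nemytskii operator `w ↦ f ∘ w` on `H¹(ℝ)`. -/
noncomputable def nem (hf : BddDeriv f) (w : H1) : H1 := mkH1 _ _ (isWeakDeriv_nem hf w)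

theorem comp_zero_nem (hf : BddDeriv f) (w : H1) : comp 0 (nem hf w) = compL2 hf (comp 0 w) := rfl

theorem comp_one_nem (hf : BddDeriv f) (w : H1) : comp 1 (nem hf w) = nemDeriv hf w := rfl

theorem coeFn_nem (hf : BddDeriv f) (w : H1) :
    comp 0 (nem hf w) =ᵐ[volume] fun z => f (comp 0 w z) := coeFn_compL2 hf (comp 0 w)

theorem coeFn_toLinf_nem (hf : BddDeriv f) (w : H1) :
    toLinf (nem hf w) =ᵐ[volume] fun z => f (comp 0 w z) :=
  (coeFn_toLinf _).trans (coeFn_nem hf w)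

theorem lipBall_nem (hf : BddDeriv f) : LipBall (nem hf) :=
  LipBall.of_comp (LipBall.lipschitz_comp (G := comp 0) (L := compL2 hf)
    (lipschitzWith_compL2 hf) (LipBall.clm (comp 0))) (lipBall_nemDeriv hf)

/-- The derivative `h ↦ f'(w) h` of the Nemytskii operator. -/
noncomputable def nemFDeriv (hf : BddDeriv f) (w : H1) : H1 →L[ℝ] H1 :=
  deriv f 0 • ContinuousLinearMap.id ℝ H1 + mulH1 (nem hf.deriv_sub w)

theorem nemFDeriv_apply (hf : BddDeriv f) (w h : H1) :
    nemFDeriv hf w h = deriv f 0 • h + mulH1 (nem hf.deriv_sub w) h := rfl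

theorem continuous_nemFDeriv_apply {X : Type*} [TopologicalSpace X] (hf : BddDeriv f)
    {w h : X → H1} (hw : Continuous w) (hh : Continuous h) :
    Continuous fun x => nemFDeriv hf (w x) (h x) := by
  have h1 : Continuous fun x => mulH1 (nem hf.deriv_sub (w x)) (h x) :=
    (mulH1.continuous.comp ((lipBall_nem hf.deriv_sub).continuous.comp hw)).clm_apply hh
  simp only [nemFDeriv_apply]
  exact (hh.const_smul (deriv f 0)).add h1

theorem coeFn_nemFDeriv (hf : BddDeriv f) (w h : H1) : comp 0 (nemFDeriv hf w h) =ᵐ[volume]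
    fun z => deriv f (comp 0 w z) * comp 0 h z := by
  rw [nemFDeriv_apply, map_add, map_smul]
  filter_upwards [Lp.coeFn_add (deriv f 0 • comp 0 h) (comp 0 (mulH1 (nem hf.deriv_sub w) h)),
    Lp.coeFn_smul (deriv f 0) (comp 0 h), coeFn_mulH1 (nem hf.deriv_sub w) h,
    coeFn_nem hf.deriv_sub w] with z h1 h2 h3 h4
  rw [h1, Pi.add_apply, h2, h3, h4, Pi.smul_apply, smul_eq_mul]
  ring

theorem coeFn_comp_one_nemFDeriv (hf : BddDeriv f) (w h : H1) :
    comp 1 (nemFDeriv hf w h) =ᵐ[volume] fun z => deriv f (comp 0 w z) * comp 1 h z +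
      comp 0 h z * (deriv (deriv f) (comp 0 w z) * comp 1 w z) := by
  rw [nemFDeriv_apply, map_add, map_smul, comp_one_mulH1, comp_one_nem]
  filter_upwards [Lp.coeFn_add (deriv f 0 • comp 1 h)
      (mulL (toLinf (nem hf.deriv_sub w)) (comp 1 h) +
        mulL (toLinf h) (nemDeriv hf.deriv_sub w)),
    Lp.coeFn_add (mulL (toLinf (nem hf.deriv_sub w)) (comp 1 h))
        (mulL (toLinf h) (nemDeriv hf.deriv_sub w)),
    Lp.coeFn_smul (deriv f 0) (comp 1 h), coeFn_mulL (toLinf (nem hf.deriv_sub w)) (comp 1 h),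
    coeFn_mulL (toLinf h) (nemDeriv hf.deriv_sub w), coeFn_toLinf_nem hf.deriv_sub w,
    coeFn_toLinf h, coeFn_nemDeriv hf.deriv_sub w] with z h1 h2 h3 h4 h5 h6 h7 h8
  rw [h1, Pi.add_apply, h2, Pi.add_apply, h3, h4, h5, h6, h7, h8, Pi.smul_apply, smul_eq_mul,
    deriv_sub_const]
  ring

theorem hasFDerivAt_nem (hf : BddDeriv f) (w : H1) : HasFDerivAt (nem hf) (nemFDeriv hf w) w := by
  set C : ℝ := (hf.deriv_sub.lip : ℝ)
  set C' : ℝ := (hf.deriv_sub.deriv_sub.lip : ℝ)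
  have hC : 0 ≤ C := NNReal.coe_nonneg _
  have hC' : 0 ≤ C' := NNReal.coe_nonneg _
  refine hasFDerivAt_of_quadratic (C + (C + C' * ‖w‖)) fun h _ => ?_
  have t0 (x y : ℝ) : |f (x + y) - f x - deriv f x * y| ≤ C * |y| ^ 2 :=
    abs_taylor_le hC hf.differentiable hf.abs_deriv_sub_le x y
  have t1 (x y : ℝ) : |deriv f (x + y) - deriv f x - deriv (deriv f) x * y| ≤ C' * |y| ^ 2 := by
    have := abs_taylor_le hC' hf.deriv_sub.differentiable hf.deriv_sub.abs_deriv_sub_le x y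
    rw [deriv_sub_const] at this
    convert this using 2
    ring
  have t2 (x y : ℝ) : |deriv f (x + y) - deriv f x| ≤ C * |y| := by
    simpa using hf.abs_deriv_sub_le (x + y) x
  have hb := ae_abs_le_norm h
  have hadd0 : (comp 0 (w + h) : ℝ → ℝ) =ᵐ[volume] comp 0 w + comp 0 h := by
    rw [map_add]
    exact Lp.coeFn_add _ _
  have hadd1 : (comp 1 (w + h) : ℝ → ℝ) =ᵐ[volume] comp 1 w + comp 1 h := by
    rw [map_add]
    exact Lp.coeFn_add _ _
  have r0 : ‖comp 0 (nem hf (w + h) - nem hf w - nemFDeriv hf w h)‖ ≤ C * ‖h‖ ^ 2 := by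
    have : ‖comp 0 (nem hf (w + h) - nem hf w - nemFDeriv hf w h)‖ ≤
        (C * ‖h‖) * ‖comp 0 h‖ := by
      refine Lp.norm_le_mul_norm_of_ae_le_mul ?_
      rw [map_sub, map_sub]
      filter_upwards [Lp.coeFn_sub (comp 0 (nem hf (w + h)) - comp 0 (nem hf w))
          (comp 0 (nemFDeriv hf w h)), Lp.coeFn_sub (comp 0 (nem hf (w + h))) (comp 0 (nem hf w)),
        coeFn_nem hf (w + h), coeFn_nem hf w, coeFn_nemFDeriv hf w h, hadd0, hb]
        with z h1 h2 h3 h4 h5 h6 h7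
      rw [h1, Pi.sub_apply, h2, Pi.sub_apply, h3, h4, h5, h6, Pi.add_apply]
      refine (t0 _ _).trans ?_
      rw [Real.norm_eq_abs, sq, mul_assoc]
      gcongr
    refine this.trans ?_
    rw [sq, ← mul_assoc]
    gcongr
    exact norm_comp_zero_le h
  have r1 : ‖comp 1 (nem hf (w + h) - nem hf w - nemFDeriv hf w h)‖ ≤
      (C + C' * ‖w‖) * ‖h‖ ^ 2 := by
    have : ‖comp 1 (nem hf (w + h) - nem hf w - nemFDeriv hf w h)‖ ≤
        (C * ‖h‖) * ‖comp 1 h‖ + (C' * ‖h‖ ^ 2) * ‖comp 1 w‖ := by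
      refine norm_le_of_ae_le_add ?_ (by positivity) (by positivity)
      rw [map_sub, map_sub]
      filter_upwards [Lp.coeFn_sub (comp 1 (nem hf (w + h)) - comp 1 (nem hf w))
          (comp 1 (nemFDeriv hf w h)), Lp.coeFn_sub (comp 1 (nem hf (w + h))) (comp 1 (nem hf w)),
        coeFn_nemDeriv hf (w + h), coeFn_nemDeriv hf w, coeFn_comp_one_nemFDeriv hf w h,
        hadd0, hadd1, hb] with z h1 h2 h3 h4 h5 h6 h8 h7
      rw [h1, Pi.sub_apply, h2, Pi.sub_apply, comp_one_nem, comp_one_nem, h3, h4, h5, h6, h8,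
        Pi.add_apply, Pi.add_apply]
      set x := comp 0 w z
      set y := comp 0 h z
      have e : deriv f (x + y) * (comp 1 w z + comp 1 h z) - deriv f x * comp 1 w z -
          (deriv f x * comp 1 h z + y * (deriv (deriv f) x * comp 1 w z)) =
          (deriv f (x + y) - deriv f x) * comp 1 h z +
          (deriv f (x + y) - deriv f x - deriv (deriv f) x * y) * comp 1 w z := by ring
      rw [e]
      refine (abs_add_le _ _).trans ?_
      rw [abs_mul, abs_mul]
      gcongr
      · exact (t2 x y).trans (by gcongr)
      · exact (t1 x y).trans (by gcongr)
    refine this.trans ?_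
    have h1 := norm_comp_one_le h
    have h2 := norm_comp_one_le w
    calc C * ‖h‖ * ‖comp 1 h‖ + C' * ‖h‖ ^ 2 * ‖comp 1 w‖
        ≤ C * ‖h‖ * ‖h‖ + C' * ‖h‖ ^ 2 * ‖w‖ := by gcongr
      _ = _ := by ring
  refine (norm_H1_le _).trans ((add_le_add r0 r1).trans_eq ?_)
  ring

end Nemytskii

theorem exists_abs_iteratedDeriv_le {f : ℝ → ℝ} (hf : ContDiff ℝ ∞ f) (hc : HasCompactSupport f)
    (k : ℕ) : ∃ C : ℝ, ∀ x, |iteratedDeriv k f x| ≤ C := by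
  have h : ∀ k : ℕ, HasCompactSupport (iteratedDeriv k f) := by
    intro k
    induction k with
    | zero => simpa using hc
    | succ k ih => rw [iteratedDeriv_succ]; exact ih.deriv
  exact (hf.continuous_iteratedDeriv k (by exact_mod_cast le_top)).bounded_above_of_compact_support
    (h k)

theorem BddDeriv.of_hasCompactSupport {f : ℝ → ℝ} (hf : ContDiff ℝ ∞ f)
    (hc : HasCompactSupport f) (h0 : f 0 = 0) : BddDeriv f :=
  ⟨hf, h0, fun k => exists_abs_iteratedDeriv_le hf hc (k + 1)⟩

/-- The primitive of `1 + f` that vanishes at `0`. -/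
noncomputable def primitive (f : ℝ → ℝ) (x : ℝ) : ℝ := x + ∫ t in (0 : ℝ)..x, f t

theorem hasDerivAt_primitive {f : ℝ → ℝ} (hf : Continuous f) (x : ℝ) :
    HasDerivAt (primitive f) (1 + f x) x :=
  (hasDerivAt_id x).add (hf.integral_hasStrictDerivAt 0 x).hasDerivAt

theorem deriv_primitive {f : ℝ → ℝ} (hf : Continuous f) : deriv (primitive f) = fun x => 1 + f x :=
  funext fun x => (hasDerivAt_primitive hf x).deriv

theorem bddDeriv_primitive {f : ℝ → ℝ} (hf : ContDiff ℝ ∞ f) (hc : HasCompactSupport f) :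
    BddDeriv (primitive f) where
  contDiff := by
    rw [contDiff_infty_iff_deriv, deriv_primitive hf.continuous]
    exact ⟨fun x => (hasDerivAt_primitive hf.continuous x).differentiableAt,
      contDiff_const.add hf⟩
  zero := by simp [primitive]
  bdd k := by
    simp only [iteratedDeriv_succ', deriv_primitive hf.continuous]
    rcases k with - | k
    · obtain ⟨C, hC⟩ := exists_abs_iteratedDeriv_le hf hc 0
      refine ⟨1 + C, fun x => ?_⟩
      have := hC x
      rw [iteratedDeriv_zero] at this ⊢
      exact (abs_add_le _ _).trans (by rw [abs_one]; linarith)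
    · obtain ⟨C, hC⟩ := exists_abs_iteratedDeriv_le hf hc (k + 1)
      refine ⟨C, fun x => ?_⟩
      have e : deriv (fun x => 1 + f x) = deriv f := by
        funext x
        rw [deriv_const_add]
      rw [iteratedDeriv_succ', e, ← iteratedDeriv_succ']
      exact hC x

theorem inner_add_mulL_self_ge {a : Linf} {c : ℝ} (h : ∀ᵐ z, c ≤ 1 + a z) (f : L2) :
    c * ‖f‖ ^ 2 ≤ inner ℝ (f + mulL a f) f := by
  have e : inner ℝ (f + mulL a f - c • f) f = ∫ z, (1 + a z - c) * (f z * f z) := by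
    rw [inner_eq_integral]
    refine integral_congr_ae ?_
    filter_upwards [Lp.coeFn_sub (f + mulL a f) (c • f), Lp.coeFn_add f (mulL a f),
      Lp.coeFn_smul c f, coeFn_mulL a f] with z h1 h2 h3 h4
    rw [h1, Pi.sub_apply, h2, Pi.add_apply, h3, h4, Pi.smul_apply, smul_eq_mul]
    ring
  have h0 : 0 ≤ inner ℝ (f + mulL a f - c • f) f := by
    rw [e]
    refine integral_nonneg_of_ae ?_
    filter_upwards [h] with z hz
    exact mul_nonneg (by linarith) (mul_self_nonneg _)
  rw [inner_sub_left, real_inner_smul_left, real_inner_self_eq_norm_sq] at h0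
  linarith

/-- `u ∈ H¹` solves `-((1 + a) u_z)_z + (1 + b) u = -r_z`, in variational form. -/
def EllipticSol (a b : Linf) (r : L2) (u : H1) : Prop :=
  ∀ v : H1, inner ℝ (comp 1 u + mulL a (comp 1 u)) (comp 1 v) +
    inner ℝ (comp 0 u + mulL b (comp 0 u)) (comp 0 v) = inner ℝ r (comp 1 v)

section Elliptic

variable {a b a' b' : Linf} {r r' : L2} {c : ℝ}

theorem coercive_form (ha : ∀ᵐ z, c ≤ 1 + a z) (hb : ∀ᵐ z, c ≤ 1 + b z) (u : H1) :
    c * ‖u‖ ^ 2 ≤ inner ℝ (comp 1 u + mulL a (comp 1 u)) (comp 1 u) +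
      inner ℝ (comp 0 u + mulL b (comp 0 u)) (comp 0 u) := by
  have h1 := inner_add_mulL_self_ge ha (comp 1 u)
  have h0 := inner_add_mulL_self_ge hb (comp 0 u)
  rw [norm_sq_H1]
  linarith

theorem exists_ellipticSol (hc : 0 < c) (ha : ∀ᵐ z, c ≤ 1 + a z) (hb : ∀ᵐ z, c ≤ 1 + b z)
    (r : L2) : ∃ u, EllipticSol a b r u := by
  let A : H1 →L[ℝ] L2 := (ContinuousLinearMap.id ℝ L2 + mulL a).comp (comp 1)
  let B : H1 →L[ℝ] L2 := (ContinuousLinearMap.id ℝ L2 + mulL b).comp (comp 0)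
  let Φ : H1 →L[ℝ] H1 →L[ℝ] ℝ := LinearMap.mkContinuous₂
    (LinearMap.mk₂ ℝ (fun u v => inner ℝ (A u) (comp 1 v) + inner ℝ (B u) (comp 0 v))
      (fun u u' v => by simp only [map_add, inner_add_left]; ring)
      (fun k u v => by simp only [map_smul, real_inner_smul_left, smul_eq_mul]; ring)
      (fun u v v' => by simp only [map_add, inner_add_right]; ring)
      (fun k u v => by simp only [map_smul, real_inner_smul_right, smul_eq_mul]; ring))
    (‖A‖ + ‖B‖) fun u v => by
      have h1 := abs_real_inner_le_norm (A u) (comp 1 v)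
      have h2 := abs_real_inner_le_norm (B u) (comp 0 v)
      have h3 : ‖A u‖ * ‖comp 1 v‖ ≤ ‖A‖ * ‖u‖ * ‖v‖ := by
        gcongr
        exacts [A.le_opNorm u, norm_comp_one_le v]
      have h4 : ‖B u‖ * ‖comp 0 v‖ ≤ ‖B‖ * ‖u‖ * ‖v‖ := by
        gcongr
        exacts [B.le_opNorm u, norm_comp_zero_le v]
      refine (abs_add_le _ _).trans ?_
      linarith
  have hco : IsCoercive Φ := ⟨c, hc, fun u => by
    have := coercive_form ha hb u
    rw [sq, ← mul_assoc] at this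
    exact this⟩
  refine ⟨hco.continuousLinearEquivOfBilin.symm (ContinuousLinearMap.adjoint (comp 1) r),
    fun v => ?_⟩
  have h := hco.continuousLinearEquivOfBilin_apply
    (hco.continuousLinearEquivOfBilin.symm (ContinuousLinearMap.adjoint (comp 1) r)) v
  rw [ContinuousLinearEquiv.apply_symm_apply, ContinuousLinearMap.adjoint_inner_left] at h
  exact h.symm

theorem EllipticSol.norm_sub_le (ha : ∀ᵐ z, c ≤ 1 + a z) (hb : ∀ᵐ z, c ≤ 1 + b z)
    {u u' : H1} (h : EllipticSol a b r u) (h' : EllipticSol a' b' r' u') :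
    c * ‖u - u'‖ ≤ ‖r - r'‖ + (‖a - a'‖ + ‖b - b'‖) * ‖u'‖ := by
  set d := u - u' with hd
  have e : inner ℝ (comp 1 d + mulL a (comp 1 d)) (comp 1 d) +
      inner ℝ (comp 0 d + mulL b (comp 0 d)) (comp 0 d) =
      inner ℝ (r - r') (comp 1 d) - inner ℝ (mulL (a - a') (comp 1 u')) (comp 1 d) -
        inner ℝ (mulL (b - b') (comp 0 u')) (comp 0 d) := by
    have h1 := h d
    have h2 := h' d
    have e1 : comp 1 d + mulL a (comp 1 d) = (comp 1 u + mulL a (comp 1 u)) -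
        (comp 1 u' + mulL a' (comp 1 u')) - mulL (a - a') (comp 1 u') := by
      rw [hd]
      simp only [map_sub, sub_apply]
      abel
    have e0 : comp 0 d + mulL b (comp 0 d) = (comp 0 u + mulL b (comp 0 u)) -
        (comp 0 u' + mulL b' (comp 0 u')) - mulL (b - b') (comp 0 u') := by
      rw [hd]
      simp only [map_sub, sub_apply]
      abel
    rw [e1, e0]
    simp only [inner_sub_left] at h1 h2 ⊢
    linarith
  have hco := coercive_form ha hb d
  rw [e] at hco
  have n1 := norm_comp_one_le d
  have n0 := norm_comp_zero_le d
  have i1 : |inner ℝ (r - r') (comp 1 d)| ≤ ‖r - r'‖ * ‖d‖ :=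
    (abs_real_inner_le_norm _ _).trans (by gcongr)
  have i2 : |inner ℝ (mulL (a - a') (comp 1 u')) (comp 1 d)| ≤ ‖a - a'‖ * ‖u'‖ * ‖d‖ :=
    (abs_real_inner_le_norm _ _).trans
      (by gcongr; exact (norm_mulL_le _ _).trans (by gcongr; exact norm_comp_one_le u'))
  have i3 : |inner ℝ (mulL (b - b') (comp 0 u')) (comp 0 d)| ≤ ‖b - b'‖ * ‖u'‖ * ‖d‖ :=
    (abs_real_inner_le_norm _ _).trans
      (by gcongr; exact (norm_mulL_le _ _).trans (by gcongr; exact norm_comp_zero_le u'))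
  rcases (norm_nonneg d).eq_or_lt with hd0 | hd0
  · rw [← hd0, mul_zero]
    positivity
  · refine le_of_mul_le_mul_right ?_ hd0
    linarith [abs_le.1 i1, abs_le.1 i2, abs_le.1 i3, (abs_le.1 i1).2, (abs_le.1 i2).1,
      (abs_le.1 i3).1]

theorem EllipticSol.unique (hc : 0 < c) (ha : ∀ᵐ z, c ≤ 1 + a z) (hb : ∀ᵐ z, c ≤ 1 + b z)
    {u u' : H1} (h : EllipticSol a b r u) (h' : EllipticSol a b r u') : u = u' := by
  have := h.norm_sub_le ha hb h'
  simp only [sub_self, norm_zero, add_zero, zero_mul] at this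
  rw [← sub_eq_zero, ← norm_le_zero_iff]
  exact nonpos_of_mul_nonpos_right this hc

theorem EllipticSol.norm_le (ha : ∀ᵐ z, c ≤ 1 + a z) (hb : ∀ᵐ z, c ≤ 1 + b z)
    {u : H1} (h : EllipticSol a b r u) : c * ‖u‖ ≤ ‖r‖ := by
  have h0 : EllipticSol a b 0 0 := fun v => by simp
  simpa using h.norm_sub_le ha hb h0

/-- The flux of a solution of the elliptic equation is weakly differentiable. -/
theorem EllipticSol.isWeakDeriv {u : H1} (h : EllipticSol a b r u) :
    IsWeakDeriv (comp 1 u + mulL a (comp 1 u) - r) (comp 0 u + mulL b (comp 0 u)) := by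
  intro v hv hc
  have := h (ofTest v (hv.of_le (by simp)) hc)
  rw [← inner_comp_one_ofTest _ v (hv.of_le (by simp)) hc,
    ← inner_comp_zero_ofTest _ v (hv.of_le (by simp)) hc, inner_sub_left]
  linarith

/-- It suffices to test the elliptic equation with smooth compactly supported functions. -/
theorem ellipticSol_iff_test {u : H1} : EllipticSol a b r u ↔
    ∀ v : ℝ → ℝ, ContDiff ℝ ∞ v → HasCompactSupport v →
      (∫ z, (comp 1 u + mulL a (comp 1 u) : L2) z * deriv v z) +
        ∫ z, (comp 0 u + mulL b (comp 0 u) : L2) z * v z = ∫ z, r z * deriv v z := by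
  refine ⟨fun h v hv hc => ?_, fun h => ?_⟩
  · have := h (ofTest v (hv.of_le (by simp)) hc)
    rwa [inner_comp_one_ofTest, inner_comp_one_ofTest, inner_comp_zero_ofTest] at this
  · intro w
    have hcl : IsClosed {w : H1 | inner ℝ (comp 1 u + mulL a (comp 1 u)) (comp 1 w) +
        inner ℝ (comp 0 u + mulL b (comp 0 u)) (comp 0 w) = inner ℝ r (comp 1 w)} :=
      isClosed_eq (by fun_prop) (by fun_prop)
    refine hcl.closure_subset_iff.2 ?_ (dense_ofTest w)
    rintro _ ⟨v, hv, hc, rfl⟩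
    change _ + _ = _
    rw [inner_comp_one_ofTest, inner_comp_one_ofTest, inner_comp_zero_ofTest]
    exact h v hv hc

end Elliptic

/-- The function `1 / (1 + f) - 1`. -/
noncomputable def recip (f : ℝ → ℝ) (x : ℝ) : ℝ := (1 + f x)⁻¹ - 1

/-- Smooth coefficients `1 + α` and `1 + β`, equal to `1` at `0` and off a compact set, and bounded
below by `c > 0`. -/
structure Coeffs (α β : ℝ → ℝ) (c : ℝ) : Prop where
  contDiff_fst : ContDiff ℝ ∞ α
  contDiff_snd : ContDiff ℝ ∞ β
  compact_fst : HasCompactSupport α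
  compact_snd : HasCompactSupport β
  zero_fst : α 0 = 0
  zero_snd : β 0 = 0
  pos : 0 < c
  le_fst : ∀ x, c ≤ 1 + α x
  le_snd : ∀ x, c ≤ 1 + β x

theorem contDiff_recip {f : ℝ → ℝ} (hf : ContDiff ℝ ∞ f) (h : ∀ x, 1 + f x ≠ 0) :
    ContDiff ℝ ∞ (recip f) :=
  ((contDiff_const.add hf).inv h).sub contDiff_const

theorem hasCompactSupport_recip {f : ℝ → ℝ} (hf : HasCompactSupport f) :
    HasCompactSupport (recip f) :=
  hf.comp_left (g := fun y => (1 + y)⁻¹ - 1) (by simp)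

namespace Coeffs

variable {α β : ℝ → ℝ} {c : ℝ}

theorem fst_pos (h : Coeffs α β c) (x : ℝ) : 0 < 1 + α x := h.pos.trans_le (h.le_fst x)

theorem snd_pos (h : Coeffs α β c) (x : ℝ) : 0 < 1 + β x := h.pos.trans_le (h.le_snd x)

theorem bdd_fst (h : Coeffs α β c) : BddDeriv α :=
  .of_hasCompactSupport h.contDiff_fst h.compact_fst h.zero_fst

theorem bdd_snd (h : Coeffs α β c) : BddDeriv β :=
  .of_hasCompactSupport h.contDiff_snd h.compact_snd h.zero_snd

theorem contDiff_recip_fst (h : Coeffs α β c) : ContDiff ℝ ∞ (recip α) :=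
  contDiff_recip h.contDiff_fst fun x => (h.fst_pos x).ne'

theorem contDiff_recip_snd (h : Coeffs α β c) : ContDiff ℝ ∞ (recip β) :=
  contDiff_recip h.contDiff_snd fun x => (h.snd_pos x).ne'

theorem bdd_recip_fst (h : Coeffs α β c) : BddDeriv (recip α) :=
  .of_hasCompactSupport h.contDiff_recip_fst (hasCompactSupport_recip h.compact_fst)
    (by simp [recip, h.zero_fst])

/-- The coefficients as elements of `L^∞` are bounded below. -/
theorem ae_le_fst (h : Coeffs α β c) (a : Linf) : ∀ᵐ z, c ≤ 1 + compLinf h.bdd_fst a z := by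
  filter_upwards [coeFn_compLinf h.bdd_fst a] with z hz
  rw [hz]
  exact h.le_fst _

theorem ae_le_snd (h : Coeffs α β c) (a : Linf) : ∀ᵐ z, c ≤ 1 + compLinf h.bdd_snd a z := by
  filter_upwards [coeFn_compLinf h.bdd_snd a] with z hz
  rw [hz]
  exact h.le_snd _

/-- `u` solves `-((1 + α(w)) u_z)_z + (1 + β(w)) u = -(α(w))_z`. -/
def Sol (h : Coeffs α β c) (w u : H1) : Prop :=
  EllipticSol (compLinf h.bdd_fst (toLinf w)) (compLinf h.bdd_snd (toLinf w))
    (compL2 h.bdd_fst (comp 0 w)) u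

theorem exists_sol (h : Coeffs α β c) (w : H1) : ∃ u, h.Sol w u :=
  exists_ellipticSol h.pos (h.ae_le_fst _) (h.ae_le_snd _) _

/-- The solution operator `w ↦ u` of the elliptic equation. -/
noncomputable def vel (h : Coeffs α β c) (w : H1) : H1 := (h.exists_sol w).choose

theorem sol_vel (h : Coeffs α β c) (w : H1) : h.Sol w (h.vel w) := (h.exists_sol w).choose_spec

theorem Sol.eq_vel {h : Coeffs α β c} {w u : H1} (hu : h.Sol w u) : u = h.vel w :=
  EllipticSol.unique h.pos (h.ae_le_fst _) (h.ae_le_snd _) hu (h.sol_vel w)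

theorem lipBall_compLinf {f : ℝ → ℝ} (hf : BddDeriv f) :
    LipBall fun w : H1 => compLinf hf (toLinf w) :=
  LipBall.lipschitz_comp (lipschitzWith_compLinf hf) (LipBall.clm toLinf)

theorem lipBall_compL2 {f : ℝ → ℝ} (hf : BddDeriv f) :
    LipBall fun w : H1 => compL2 hf (comp 0 w) :=
  LipBall.lipschitz_comp (lipschitzWith_compL2 hf) (LipBall.clm (comp 0))

theorem lipBall_vel (h : Coeffs α β c) : LipBall h.vel := by
  refine LipBall.of_bound fun R hR => ?_
  obtain ⟨K1, -, hK10, -, hK1, -⟩ := (lipBall_compLinf h.bdd_fst).exists_bound R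
  obtain ⟨K2, -, hK20, -, hK2, -⟩ := (lipBall_compLinf h.bdd_snd).exists_bound R
  obtain ⟨K3, M, -, hM0, hK3, hM⟩ := (lipBall_compL2 h.bdd_fst).exists_bound R
  have hcp := h.pos
  refine ⟨(K3 + (K1 + K2) * (M / c)) / c, fun x y hx hy => ?_⟩
  have h1 := EllipticSol.norm_sub_le (h.ae_le_fst _) (h.ae_le_snd _) (h.sol_vel x) (h.sol_vel y)
  have h2 : ‖h.vel y‖ ≤ M / c := by
    rw [le_div_iff₀' hcp]
    exact (EllipticSol.norm_le (h.ae_le_fst _) (h.ae_le_snd _) (h.sol_vel y)).trans (hM y hy)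
  rw [div_mul_eq_mul_div, le_div_iff₀' hcp]
  refine h1.trans ?_
  have h3 := hK1 x y hx hy
  have h4 := hK2 x y hx hy
  have h5 := hK3 x y hx hy
  calc _ ≤ K3 * ‖x - y‖ + (K1 * ‖x - y‖ + K2 * ‖x - y‖) * (M / c) := by gcongr
    _ = _ := by ring

/-- The flux `(1 + α(w)) u_z - α(w)` as an element of `H¹`. -/
noncomputable def flux (h : Coeffs α β c) (w : H1) : H1 := mkH1 _ _ (h.sol_vel w).isWeakDeriv

theorem lipBall_flux (h : Coeffs α β c) : LipBall h.flux := by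
  have h0 := LipBall.clm_comp (comp 0) h.lipBall_vel
  have h1 := LipBall.clm_comp (comp 1) h.lipBall_vel
  exact LipBall.of_comp
    ((h1.add (LipBall.bilin mulL (lipBall_compLinf h.bdd_fst) h1)).sub (lipBall_compL2 h.bdd_fst))
    (h0.add (LipBall.bilin mulL (lipBall_compLinf h.bdd_snd) h0))

/-- The derivative `u_z` of the velocity as an element of `H¹`. -/
noncomputable def velDeriv (h : Coeffs α β c) (w : H1) : H1 :=
  h.flux w + mulH1 (nem h.bdd_recip_fst w) (h.flux w) - nem h.bdd_recip_fst w

theorem lipBall_velDeriv (h : Coeffs α β c) : LipBall h.velDeriv :=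
  (h.lipBall_flux.add (LipBall.bilin mulH1 (lipBall_nem h.bdd_recip_fst) h.lipBall_flux)).sub
    (lipBall_nem h.bdd_recip_fst)

theorem comp_zero_velDeriv (h : Coeffs α β c) (w : H1) :
    comp 0 (h.velDeriv w) = comp 1 (h.vel w) := by
  refine Lp.ext ?_
  set y := h.flux w with hy
  set k := nem h.bdd_recip_fst w with hk
  set u := h.vel w with hu
  have e : comp 0 (h.velDeriv w) = comp 0 y + comp 0 (mulH1 k y) - comp 0 k := by
    rw [velDeriv, map_sub, map_add]
  have ey : comp 0 y = comp 1 u + mulL (compLinf h.bdd_fst (toLinf w)) (comp 1 u) -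
    compL2 h.bdd_fst (comp 0 w) := rfl
  have hy0 : comp 0 y =ᵐ[volume] fun z =>
      comp 1 u z + α (comp 0 w z) * comp 1 u z - α (comp 0 w z) := by
    rw [ey]
    filter_upwards [Lp.coeFn_sub (comp 1 u + mulL (compLinf h.bdd_fst (toLinf w)) (comp 1 u))
        (compL2 h.bdd_fst (comp 0 w)),
      Lp.coeFn_add (comp 1 u) (mulL (compLinf h.bdd_fst (toLinf w)) (comp 1 u)),
      coeFn_mulL (compLinf h.bdd_fst (toLinf w)) (comp 1 u),
      coeFn_compLinf h.bdd_fst (toLinf w), coeFn_toLinf w, coeFn_compL2 h.bdd_fst (comp 0 w)]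
      with z h1 h2 h3 h4 h5 h6
    rw [h1, Pi.sub_apply, h2, Pi.add_apply, h3, h4, h5, h6]
  rw [e]
  filter_upwards [Lp.coeFn_sub (comp 0 y + comp 0 (mulH1 k y)) (comp 0 k),
    Lp.coeFn_add (comp 0 y) (comp 0 (mulH1 k y)), coeFn_mulH1 k y,
    coeFn_nem h.bdd_recip_fst w, hy0] with z h1 h2 h3 h4 h5
  rw [h1, Pi.sub_apply, h2, Pi.add_apply, h3, h4, h5, recip]
  have := (h.fst_pos (comp 0 w z)).ne'
  field_simp
  ring

/-- The vector field `w ↦ (1 + β(w)) u`. -/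
noncomputable def field (h : Coeffs α β c) (w : H1) : H1 :=
  h.vel w + mulH1 (nem h.bdd_snd w) (h.vel w)

theorem lipBall_field (h : Coeffs α β c) : LipBall h.field :=
  h.lipBall_vel.add (LipBall.bilin mulH1 (lipBall_nem h.bdd_snd) h.lipBall_vel)

theorem coeFn_field (h : Coeffs α β c) (w : H1) : comp 0 (h.field w) =ᵐ[volume]
    fun z => (1 + β (comp 0 w z)) * comp 0 (h.vel w) z := by
  rw [field, map_add]
  filter_upwards [Lp.coeFn_add (comp 0 (h.vel w)) (comp 0 (mulH1 (nem h.bdd_snd w) (h.vel w))),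
    coeFn_mulH1 (nem h.bdd_snd w) (h.vel w), coeFn_nem h.bdd_snd w] with z h1 h2 h3
  rw [h1, Pi.add_apply, h2, h3]
  ring

theorem bdd_stream (h : Coeffs α β c) : BddDeriv (primitive (recip β)) :=
  bddDeriv_primitive h.contDiff_recip_snd (hasCompactSupport_recip h.compact_snd)

theorem deriv_stream (h : Coeffs α β c) (x : ℝ) :
    deriv (primitive (recip β)) x = (1 + β x)⁻¹ := by
  rw [deriv_primitive h.contDiff_recip_snd.continuous]
  simp [recip]

/-- In the variable `ψ = Γ(w)`, `Γ' = 1 / (1 + β)`, the equation reads `ψ_t = u`. -/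
theorem nemFDeriv_stream_field (h : Coeffs α β c) (w : H1) :
    nemFDeriv h.bdd_stream w (h.field w) = h.vel w := by
  refine H1.ext_zero (Lp.ext ?_)
  filter_upwards [coeFn_nemFDeriv h.bdd_stream w (h.field w), h.coeFn_field w] with z h1 h2
  rw [h1, h2, h.deriv_stream, inv_mul_cancel_left₀ (h.snd_pos _).ne']

end Coeffs

/-- `∫ f(w) w_z = 0` for `w ∈ H¹`. -/
theorem inner_compL2_comp_one {f : ℝ → ℝ} (hf : BddDeriv f) (w : H1) :
    inner ℝ (compL2 hf (comp 0 w)) (comp 1 w) = 0 := by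
  have hcl : IsClosed {w : H1 | inner ℝ (compL2 hf (comp 0 w)) (comp 1 w) = 0} :=
    isClosed_eq ((((lipschitzWith_compL2 hf).continuous.comp (comp 0).continuous)).inner
      (comp 1).continuous) continuous_const
  refine hcl.closure_subset_iff.2 ?_ (dense_ofTest w)
  rintro _ ⟨v, hv, hc, rfl⟩
  have hv1 : ContDiff ℝ 1 v := hv.of_le (by simp)
  have hv' : Continuous (deriv v) := hv.continuous_deriv (by simp)
  have hfc : Continuous f := hf.contDiff.continuous
  change inner ℝ _ _ = (0 : ℝ)
  rw [inner_comp_one_ofTest]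
  have e : ∫ z, (compL2 hf (comp 0 (ofTest v hv1 hc)) : L2) z * deriv v z =
      ∫ z, f (v z) * deriv v z := by
    refine integral_congr_ae ?_
    filter_upwards [coeFn_compL2 hf (comp 0 (ofTest v hv1 hc)), coeFn_ofTest_zero v hv1 hc]
      with z h1 h2
    rw [h1, h2]
  rw [e]
  set P : ℝ → ℝ := fun x => ∫ t in (0 : ℝ)..x, f t with hP
  have hPd (x : ℝ) : HasDerivAt P (f x) x := (hfc.integral_hasStrictDerivAt 0 x).hasDerivAt
  have hPc : Continuous P := continuous_iff_continuousAt.2 fun x => (hPd x).continuousAt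
  exact integral_eq_zero_of_hasDerivAt_of_integrable (f := fun z => P (v z))
    (fun z => (hPd (v z)).comp z (hv1.differentiable (by simp) z).hasDerivAt)
    (((hfc.comp hv.continuous).mul hv').integrable_of_hasCompactSupport hc.deriv.mul_left)
    ((hPc.comp hv.continuous).integrable_of_hasCompactSupport (hc.comp_left (by simp [hP])))

section Potential

variable {F W : ℝ → ℝ} (hF : ∀ x, HasDerivAt F (W x) x) (hF0 : F 0 = 0) (hW : BddDeriv W)

include hF hW in
theorem abs_potential_taylor_le (x y : ℝ) :
    |F (x + y) - F x - W x * y| ≤ hW.lip * |y| ^ 2 := by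
  have hd : deriv F = W := funext fun x => (hF x).deriv
  have := abs_taylor_le (f := F) (C := hW.lip) (NNReal.coe_nonneg _)
    (fun x => (hF x).differentiableAt)
    (fun x y => by
      rw [hd]
      simpa [Real.dist_eq] using hW.lipschitzWith.dist_le_mul x y) x y
  rwa [hd] at this

include hF hF0 hW in
theorem abs_potential_le (x : ℝ) : |F x| ≤ hW.lip * |x| ^ 2 := by
  simpa [hF0, hW.zero] using abs_potential_taylor_le hF hW 0 x

theorem integrable_sq_L2 (f : L2) : Integrable fun z => |f z| ^ 2 := by
  simpa using (Lp.memLp f).integrable_sq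

theorem integral_sq_L2 (f : L2) : ∫ z, |f z| ^ 2 = ‖f‖ ^ 2 := by
  rw [← real_inner_self_eq_norm_sq, inner_eq_integral]
  simp [sq]

include hF hF0 hW in
theorem integrable_potential (f : L2) : Integrable fun z => F (f z) := by
  have hFc : Continuous F := continuous_iff_continuousAt.2 fun x => (hF x).continuousAt
  refine ((integrable_sq_L2 f).const_mul (hW.lip : ℝ)).mono'
    (hFc.comp_aestronglyMeasurable (Lp.aestronglyMeasurable f)) ?_
  exact Eventually.of_forall fun z => abs_potential_le hF hF0 hW (f z)

include hF hF0 hW in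
theorem hasFDerivAt_potential (f : L2) : HasFDerivAt (fun f : L2 => ∫ z, F (f z))
    (innerSL ℝ (compL2 hW f)) f := by
  refine hasFDerivAt_of_quadratic hW.lip fun g _ => ?_
  have i1 := integrable_potential hF hF0 hW (f + g)
  have i2 := integrable_potential hF hF0 hW f
  have i3 : Integrable fun z => (compL2 hW f : L2) z * g z :=
    (Lp.memLp (compL2 hW f)).integrable_mul (Lp.memLp g)
  have i4 : Integrable fun z => F ((f + g : L2) z) - F (f z) := i1.sub i2
  rw [innerSL_apply_apply, inner_eq_integral, ← integral_sub i1 i2, ← integral_sub i4 i3,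
    ← integral_sq_L2, ← integral_const_mul]
  refine norm_integral_le_of_norm_le ((integrable_sq_L2 g).const_mul _) ?_
  filter_upwards [Lp.coeFn_add f g, coeFn_compL2 hW f] with z h1 h2
  rw [h1, h2, Pi.add_apply]
  exact abs_potential_taylor_le hF hW (f z) (g z)

include hF hF0 hW in
theorem integral_potential_le (f : L2) : ∫ z, F (f z) ≤ hW.lip * ‖f‖ ^ 2 := by
  rw [← integral_sq_L2, ← integral_const_mul]
  exact integral_mono (integrable_potential hF hF0 hW f) ((integrable_sq_L2 f).const_mul _)
    fun z => (le_abs_self _).trans (abs_potential_le hF hF0 hW (f z))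

include hF hF0 in
theorem le_potential {k : ℝ} (hk : ∀ x, HasDerivAt W (deriv W x) x) (hW0 : W 0 = 0)
    (hkW : ∀ x, k ≤ deriv W x) (x : ℝ) : k / 2 * |x| ^ 2 ≤ F x := by
  have mono : Monotone fun x => W x - k * x := by
    refine monotone_of_hasDerivAt_nonneg (f' := fun x => deriv W x - k) (fun x => ?_)
      fun x => sub_nonneg.2 (hkW x)
    exact ((hk x).sub ((hasDerivAt_id x).const_mul k)).congr_deriv (by ring)
  have hd (x : ℝ) : HasDerivAt (fun x => F x - k / 2 * x ^ 2) (W x - k * x) x :=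
    ((hF x).sub ((hasDerivAt_pow 2 x).const_mul (k / 2))).congr_deriv (by simp; ring)
  have hcont : Continuous fun x => F x - k / 2 * x ^ 2 :=
    continuous_iff_continuousAt.2 fun x => (hd x).continuousAt
  have key : 0 ≤ F x - k / 2 * x ^ 2 := by
    rcases le_total 0 x with hx | hx
    · have := monotoneOn_of_deriv_nonneg (convex_Ici (0 : ℝ)) hcont.continuousOn
        (fun x _ => (hd x).differentiableAt.differentiableWithinAt) (fun x hx => by
          rw [(hd x).deriv]
          rw [interior_Ici] at hx
          simpa [hW0] using mono hx.le) self_mem_Ici hx hx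
      simpa [hF0] using this
    · have := antitoneOn_of_deriv_nonpos (convex_Iic (0 : ℝ)) hcont.continuousOn
        (fun x _ => (hd x).differentiableAt.differentiableWithinAt) (fun x hx => by
          rw [(hd x).deriv]
          rw [interior_Iic] at hx
          simpa [hW0] using mono hx.le) hx self_mem_Iic hx
      simpa [hF0] using this
  rw [sq_abs]
  linarith

end Potential

namespace Coeffs

variable {α β : ℝ → ℝ} {c : ℝ}

/-- The function `W - x`, where `W' = 1 / ((1 + α)(1 + β))`, has this derivative. -/
noncomputable def weight (α β : ℝ → ℝ) (x : ℝ) : ℝ := ((1 + α x) * (1 + β x))⁻¹ - 1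

theorem contDiff_weight (h : Coeffs α β c) : ContDiff ℝ ∞ (weight α β) :=
  (((contDiff_const.add h.contDiff_fst).mul (contDiff_const.add h.contDiff_snd)).inv
    fun x => (mul_pos (h.fst_pos x) (h.snd_pos x)).ne').sub contDiff_const

theorem hasCompactSupport_weight (h : Coeffs α β c) : HasCompactSupport (weight α β) :=
  h.compact_fst.comp₂_left h.compact_snd (m := fun a b => ((1 + a) * (1 + b))⁻¹ - 1) (by simp)

theorem bdd_multiplier (h : Coeffs α β c) : BddDeriv (primitive (weight α β)) :=
  bddDeriv_primitive h.contDiff_weight h.hasCompactSupport_weight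

theorem deriv_multiplier (h : Coeffs α β c) (x : ℝ) :
    deriv (primitive (weight α β)) x = ((1 + α x) * (1 + β x))⁻¹ := by
  rw [deriv_primitive h.contDiff_weight.continuous]
  simp [weight]

/-- The potential energy density. -/
noncomputable def density (α β : ℝ → ℝ) (x : ℝ) : ℝ :=
  ∫ t in (0 : ℝ)..x, primitive (weight α β) t

theorem hasDerivAt_density (h : Coeffs α β c) (x : ℝ) :
    HasDerivAt (density α β) (primitive (weight α β) x) x :=
  (h.bdd_multiplier.contDiff.continuous.integral_hasStrictDerivAt 0 x).hasDerivAt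

theorem density_zero : density α β 0 = 0 := by simp [density]

/-- The conserved energy `½ ∫ w_z² / (1 + β(w))² + ∫ density(w)`. -/
noncomputable def energy (h : Coeffs α β c) (w : H1) : ℝ :=
  1 / 2 * ‖comp 1 (nem h.bdd_stream w)‖ ^ 2 + ∫ z, density α β (comp 0 w z)

/-- The derivative of the energy. -/
noncomputable def energyDeriv (h : Coeffs α β c) (w : H1) : H1 →L[ℝ] ℝ :=
  (innerSL ℝ (comp 1 (nem h.bdd_stream w))).comp ((comp 1).comp (nemFDeriv h.bdd_stream w)) +
    (innerSL ℝ (compL2 h.bdd_multiplier (comp 0 w))).comp (comp 0)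

theorem hasFDerivAt_energy (h : Coeffs α β c) (w : H1) :
    HasFDerivAt h.energy (h.energyDeriv w) w := by
  have h1 : HasFDerivAt (fun w => comp 1 (nem h.bdd_stream w))
      ((comp 1).comp (nemFDeriv h.bdd_stream w)) w :=
    (comp 1).hasFDerivAt.comp w (hasFDerivAt_nem h.bdd_stream w)
  have h2 := h1.norm_sq.const_mul (1 / 2)
  have h3 := (hasFDerivAt_potential h.hasDerivAt_density density_zero h.bdd_multiplier
    (comp 0 w)).comp w (comp 0).hasFDerivAt
  refine (h2.add h3).congr_fderiv ?_
  ext v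
  simp [energyDeriv]

theorem bdd_cancel (h : Coeffs α β c) :
    BddDeriv fun x => α x * ((1 + α x) * (1 + β x))⁻¹ := by
  refine .of_hasCompactSupport (h.contDiff_fst.mul
    (((contDiff_const.add h.contDiff_fst).mul (contDiff_const.add h.contDiff_snd)).inv
    fun x => (mul_pos (h.fst_pos x) (h.snd_pos x)).ne')) h.compact_fst.mul_right ?_
  simp [h.zero_fst]

/-- The energy is conserved along the vector field. -/
theorem energyDeriv_field (h : Coeffs α β c) (w : H1) : h.energyDeriv w (h.field w) = 0 := by
  have hs := h.sol_vel w (nem h.bdd_multiplier w)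
  set u := h.vel w with hu
  have e0 : inner ℝ (compL2 h.bdd_multiplier (comp 0 w)) (comp 0 (h.field w)) =
      inner ℝ (comp 0 u + mulL (compLinf h.bdd_snd (toLinf w)) (comp 0 u))
        (comp 0 (nem h.bdd_multiplier w)) := by
    rw [inner_eq_integral, inner_eq_integral]
    refine integral_congr_ae ?_
    filter_upwards [h.coeFn_field w,
      Lp.coeFn_add (comp 0 u) (mulL (compLinf h.bdd_snd (toLinf w)) (comp 0 u)),
      coeFn_mulL (compLinf h.bdd_snd (toLinf w)) (comp 0 u),
      coeFn_compLinf h.bdd_snd (toLinf w), coeFn_toLinf w] with z h1 h2 h3 h4 h5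
    rw [h1, h2, Pi.add_apply, h3, h4, h5, comp_zero_nem]
    ring
  have e1 : inner ℝ (comp 1 (nem h.bdd_stream w)) (comp 1 u) =
      inner ℝ (comp 1 u + mulL (compLinf h.bdd_fst (toLinf w)) (comp 1 u))
        (comp 1 (nem h.bdd_multiplier w)) := by
    rw [inner_eq_integral, inner_eq_integral]
    refine integral_congr_ae ?_
    filter_upwards [coeFn_nemDeriv h.bdd_stream w, coeFn_nemDeriv h.bdd_multiplier w,
      Lp.coeFn_add (comp 1 u) (mulL (compLinf h.bdd_fst (toLinf w)) (comp 1 u)),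
      coeFn_mulL (compLinf h.bdd_fst (toLinf w)) (comp 1 u),
      coeFn_compLinf h.bdd_fst (toLinf w), coeFn_toLinf w] with z h1 h6 h2 h3 h4 h5
    rw [comp_one_nem, comp_one_nem, h1, h6, h2, Pi.add_apply, h3, h4, h5, h.deriv_stream,
      h.deriv_multiplier]
    have p1 := (h.fst_pos (comp 0 w z)).ne'
    have p2 := (h.snd_pos (comp 0 w z)).ne'
    field_simp
  have e2 : inner ℝ (compL2 h.bdd_fst (comp 0 w)) (comp 1 (nem h.bdd_multiplier w)) =
      inner ℝ (compL2 h.bdd_cancel (comp 0 w)) (comp 1 w) := by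
    rw [inner_eq_integral, inner_eq_integral]
    refine integral_congr_ae ?_
    filter_upwards [coeFn_nemDeriv h.bdd_multiplier w, coeFn_compL2 h.bdd_fst (comp 0 w),
      coeFn_compL2 h.bdd_cancel (comp 0 w)] with z h1 h2 h3
    rw [comp_one_nem, h1, h2, h3, h.deriv_multiplier]
    ring
  rw [e2, inner_compL2_comp_one] at hs
  change inner ℝ (comp 1 (nem h.bdd_stream w))
    (comp 1 (nemFDeriv h.bdd_stream w (h.field w))) +
      inner ℝ (compL2 h.bdd_multiplier (comp 0 w)) (comp 0 (h.field w)) = 0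
  rw [h.nemFDeriv_stream_field, e0, e1]
  exact hs

theorem exists_le (h : Coeffs α β c) : ∃ B : ℝ, 1 ≤ B ∧ (∀ x, 1 + α x ≤ B) ∧ ∀ x, 1 + β x ≤ B := by
  obtain ⟨C1, hC1⟩ := h.contDiff_fst.continuous.bounded_above_of_compact_support h.compact_fst
  obtain ⟨C2, hC2⟩ := h.contDiff_snd.continuous.bounded_above_of_compact_support h.compact_snd
  have p1 : 0 ≤ C1 := (norm_nonneg _).trans (hC1 0)
  have p2 : 0 ≤ C2 := (norm_nonneg _).trans (hC2 0)
  exact ⟨1 + C1 + C2, by linarith, fun x => by linarith [(le_abs_self _).trans (hC1 x)],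
    fun x => by linarith [(le_abs_self _).trans (hC2 x)]⟩

/-- The energy is equivalent to the square of the `H¹` norm. -/
theorem exists_energy_bounds (h : Coeffs α β c) : ∃ k K : ℝ, 0 < k ∧ 0 < K ∧
    ∀ w, k * ‖w‖ ^ 2 ≤ h.energy w ∧ h.energy w ≤ K * ‖w‖ ^ 2 := by
  obtain ⟨B, hB1, hBα, hBβ⟩ := h.exists_le
  have hB : 0 < B := by linarith
  have hc := h.pos
  set L : ℝ := (h.bdd_multiplier.lip : ℝ)
  have hL : 0 ≤ L := NNReal.coe_nonneg _
  refine ⟨1 / 2 * (B ^ 2)⁻¹, 1 / 2 * (c ^ 2)⁻¹ + L, by positivity, by positivity, fun w => ?_⟩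
  have hW (x : ℝ) : (B ^ 2)⁻¹ ≤ deriv (primitive (weight α β)) x := by
    rw [h.deriv_multiplier, sq]
    have p1 := h.fst_pos x
    have p2 := h.snd_pos x
    gcongr
    exacts [hBα x, hBβ x]
  have u0 := integral_potential_le h.hasDerivAt_density density_zero h.bdd_multiplier (comp 0 w)
  have l0 : 1 / 2 * (B ^ 2)⁻¹ * ‖comp 0 w‖ ^ 2 ≤ ∫ z, density α β (comp 0 w z) := by
    rw [← integral_sq_L2, ← integral_const_mul]
    refine integral_mono ((integrable_sq_L2 _).const_mul _)
      (integrable_potential h.hasDerivAt_density density_zero h.bdd_multiplier _) fun z => ?_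
    have := le_potential h.hasDerivAt_density density_zero
      (fun x => (h.bdd_multiplier.differentiable x).hasDerivAt) h.bdd_multiplier.zero hW
      (comp 0 w z)
    refine le_trans (le_of_eq ?_) this
    ring
  have l1 : ‖comp 1 w‖ ≤ B * ‖comp 1 (nem h.bdd_stream w)‖ := by
    refine Lp.norm_le_mul_norm_of_ae_le_mul ?_
    filter_upwards [coeFn_nemDeriv h.bdd_stream w] with z hz
    have p2 := h.snd_pos (comp 0 w z)
    rw [comp_one_nem, hz, h.deriv_stream, norm_mul, norm_inv, ← mul_assoc,
      Real.norm_of_nonneg p2.le]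
    refine le_mul_of_one_le_left (norm_nonneg _) ?_
    rw [← div_eq_mul_inv, one_le_div p2]
    exact hBβ _
  have u1 : ‖comp 1 (nem h.bdd_stream w)‖ ≤ c⁻¹ * ‖comp 1 w‖ := by
    refine Lp.norm_le_mul_norm_of_ae_le_mul ?_
    filter_upwards [coeFn_nemDeriv h.bdd_stream w] with z hz
    have p2 := h.snd_pos (comp 0 w z)
    rw [comp_one_nem, hz, h.deriv_stream, norm_mul, norm_inv, Real.norm_of_nonneg p2.le]
    gcongr
    exact h.le_snd _
  have l1' : (B ^ 2)⁻¹ * ‖comp 1 w‖ ^ 2 ≤ ‖comp 1 (nem h.bdd_stream w)‖ ^ 2 := by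
    rw [inv_mul_le_iff₀ (by positivity), ← mul_pow]
    gcongr
  have u1' : ‖comp 1 (nem h.bdd_stream w)‖ ^ 2 ≤ (c ^ 2)⁻¹ * ‖comp 1 w‖ ^ 2 := by
    rw [← inv_pow, ← mul_pow]
    gcongr
  have n0 : 0 ≤ ‖comp 0 w‖ ^ 2 := by positivity
  have n1 : 0 ≤ ‖comp 1 w‖ ^ 2 := by positivity
  have n2 : 0 ≤ (c ^ 2)⁻¹ * ‖comp 0 w‖ ^ 2 := by positivity
  have n3 : 0 ≤ L * ‖comp 1 w‖ ^ 2 := by positivity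
  rw [norm_sq_H1 w, energy]
  constructor
  · linarith
  · linarith

end Coeffs

namespace LipBall

variable {E : Type*} [NormedAddCommGroup E] [NormedSpace ℝ E] {G : E → E}

theorem ode_unique_right (hG : LipBall G) {f g : ℝ → E} {a b : ℝ}
    (hf : ContinuousOn f (Icc a b))
    (hf' : ∀ t ∈ Ico a b, HasDerivWithinAt f (G (f t)) (Ici t) t)
    (hg : ContinuousOn g (Icc a b))
    (hg' : ∀ t ∈ Ico a b, HasDerivWithinAt g (G (g t)) (Ici t) t)
    (ha : f a = g a) : EqOn f g (Icc a b) := by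
  obtain ⟨R1, h1⟩ := isCompact_Icc.exists_bound_of_continuousOn hf
  obtain ⟨R2, h2⟩ := isCompact_Icc.exists_bound_of_continuousOn hg
  obtain ⟨K, hK⟩ := hG (max R1 R2)
  refine ODE_solution_unique_of_mem_Icc_right (v := fun _ => G)
    (s := fun _ => Metric.closedBall 0 (max R1 R2)) (fun _ _ => hK) hf hf' (fun t ht => ?_) hg hg'
    (fun t ht => ?_) ha
  · exact mem_closedBall_zero_iff.2 ((h1 t (Ico_subset_Icc_self ht)).trans (le_max_left _ _))
  · exact mem_closedBall_zero_iff.2 ((h2 t (Ico_subset_Icc_self ht)).trans (le_max_right _ _))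

theorem ode_unique (hG : LipBall G) {f g : ℝ → E} {a b : ℝ}
    (h0 : (0 : ℝ) ∈ Ioo a b)
    (hf : ∀ t ∈ Icc a b, HasDerivWithinAt f (G (f t)) (Icc a b) t)
    (hg : ∀ t ∈ Icc a b, HasDerivWithinAt g (G (g t)) (Icc a b) t)
    (h : f 0 = g 0) : EqOn f g (Icc a b) := by
  have cf : ContinuousOn f (Icc a b) := fun t ht => (hf t ht).continuousWithinAt
  have cg : ContinuousOn g (Icc a b) := fun t ht => (hg t ht).continuousWithinAt
  obtain ⟨R1, h1⟩ := isCompact_Icc.exists_bound_of_continuousOn cf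
  obtain ⟨R2, h2⟩ := isCompact_Icc.exists_bound_of_continuousOn cg
  obtain ⟨K, hK⟩ := hG (max R1 R2)
  refine ODE_solution_unique_of_mem_Icc (v := fun _ => G)
    (s := fun _ => Metric.closedBall 0 (max R1 R2)) (fun _ _ => hK) h0 cf
    (fun t ht => (hf t (Ioo_subset_Icc_self ht)).hasDerivAt (Icc_mem_nhds ht.1 ht.2))
    (fun t ht => ?_) cg
    (fun t ht => (hg t (Ioo_subset_Icc_self ht)).hasDerivAt (Icc_mem_nhds ht.1 ht.2))
    (fun t ht => ?_) h
  · exact mem_closedBall_zero_iff.2 ((h1 t (Ioo_subset_Icc_self ht)).trans (le_max_left _ _))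
  · exact mem_closedBall_zero_iff.2 ((h2 t (Ioo_subset_Icc_self ht)).trans (le_max_right _ _))

/-- A bounded vector field that is Lipschitz on balls has global integral curves. -/
theorem exists_integralCurve [CompleteSpace E] (hG : LipBall G) {M : ℝ} (hM : ∀ x, ‖G x‖ ≤ M)
    (x₀ : E) : ∃ y : ℝ → E, y 0 = x₀ ∧ ∀ t, HasDerivAt y (G (y t)) t := by
  have hM0 : 0 ≤ M := (norm_nonneg _).trans (hM 0)
  have loc (n : ℕ) : ∃ y : ℝ → E, y 0 = x₀ ∧ ∀ t ∈ Icc (-(n + 1 : ℝ)) (n + 1),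
      HasDerivWithinAt y (G (y t)) (Icc (-(n + 1 : ℝ)) (n + 1)) t := by
    have h0 : (0 : ℝ) ∈ Icc (-(n + 1 : ℝ)) (n + 1) := ⟨by linarith, by linarith⟩
    set L : ℝ≥0 := ⟨M, hM0⟩
    set a : ℝ≥0 := L * (n + 1) with ha
    obtain ⟨K, hK⟩ := hG (‖x₀‖ + a)
    have hPL : IsPicardLindelof (fun _ => G) (⟨0, h0⟩ : Icc (-(n + 1 : ℝ)) (n + 1)) x₀ a 0 L K := by
      refine IsPicardLindelof.of_time_independent (fun x _ => hM x) (hK.mono ?_) ?_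
      · refine Metric.closedBall_subset_closedBall' ?_
        rw [dist_zero_right, add_comm]
      · simp [ha]
    exact hPL.exists_eq_forall_mem_Icc_hasDerivWithinAt₀
  choose y hy0 hy using loc
  have agree (n m : ℕ) (hnm : n ≤ m) : EqOn (y n) (y m) (Icc (-(n + 1 : ℝ)) (n + 1)) := by
    have hc : (n : ℝ) ≤ m := by exact_mod_cast hnm
    have hsub : Icc (-(n + 1 : ℝ)) (n + 1) ⊆ Icc (-(m + 1 : ℝ)) (m + 1) :=
      Icc_subset_Icc (by linarith) (by linarith)
    exact hG.ode_unique ⟨by linarith, by linarith⟩ (hy n)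
      (fun t ht => (hy m t (hsub ht)).mono hsub) ((hy0 n).trans (hy0 m).symm)
  refine ⟨fun t => y ⌈|t|⌉₊ t, by simpa using hy0 0, fun t => ?_⟩
  set N := ⌈|t|⌉₊ + 1
  have key (s : ℝ) (hs : |s| < N + 1) : y ⌈|s|⌉₊ s = y N s := by
    rcases le_total ⌈|s|⌉₊ N with h | h
    · refine agree _ _ h ?_
      have := Nat.le_ceil |s|
      exact abs_le.1 (this.trans (by linarith))
    · exact (agree _ _ h (abs_le.1 hs.le)).symm
  have ht : |t| < N + 1 := by
    have := Nat.le_ceil |t|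
    simp only [N]
    push_cast
    linarith
  have hev : (fun t => y ⌈|t|⌉₊ t) =ᶠ[𝓝 t] y N := by
    filter_upwards [(isOpen_lt continuous_abs continuous_const).mem_nhds ht] with s hs
    exact key s hs
  have hd := (hy N t (abs_le.1 ht.le)).hasDerivAt (Icc_mem_nhds (abs_lt.1 ht).1 (abs_lt.1 ht).2)
  refine HasDerivAt.congr_of_eventuallyEq ?_ hev
  change HasDerivAt (y N) (G (y ⌈|t|⌉₊ t)) t
  rwa [key t ht]

end LipBall

/-- A cut-off equal to `1` on the unit ball and to `0` off the ball of radius `2`. -/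
noncomputable def cutoff {E : Type*} [NormedAddCommGroup E] (x : E) : ℝ := max 0 (min 1 (2 - ‖x‖))

theorem lipBall_cutoff {E : Type*} [NormedAddCommGroup E] : LipBall (cutoff : E → ℝ) := by
  refine LipBall.of_bound fun R _ => ⟨1, fun x y _ _ => ?_⟩
  have h : LipschitzWith 1 fun s : ℝ => max 0 (min 1 (2 - s)) :=
    ((LipschitzWith.of_dist_le_mul (K := 1) fun s t => by
      rw [Real.dist_eq, Real.dist_eq, NNReal.coe_one, one_mul, sub_sub_sub_cancel_left,
        abs_sub_comm]).const_min 1).const_max 0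
  have := h.dist_le_mul ‖x‖ ‖y‖
  rw [Real.dist_eq, Real.dist_eq, NNReal.coe_one, one_mul] at this
  rw [one_mul]
  exact this.trans (abs_norm_sub_norm_le x y)

theorem cutoff_eq_one {E : Type*} [NormedAddCommGroup E] {x : E} (h : ‖x‖ ≤ 1) : cutoff x = 1 := by
  rw [cutoff, min_eq_left (by linarith), max_eq_right zero_le_one]

theorem cutoff_eq_zero {E : Type*} [NormedAddCommGroup E] {x : E} (h : 2 ≤ ‖x‖) : cutoff x = 0 := by
  rw [cutoff, max_eq_left]
  exact (min_le_right _ _).trans (by linarith)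

theorem abs_cutoff_le_one {E : Type*} [NormedAddCommGroup E] (x : E) : |cutoff x| ≤ 1 := by
  rw [cutoff, abs_of_nonneg (le_max_left _ _)]
  exact max_le zero_le_one (min_le_left _ _)

namespace Coeffs

variable {α β : ℝ → ℝ} {c : ℝ}

/-- Global flow of the vector field for small data, with a bound by the data. -/
theorem exists_flow (h : Coeffs α β c) : ∃ C : ℝ, 0 < C ∧ ∀ w₀ : H1, C * ‖w₀‖ ≤ 1 →
    ∃ w : ℝ → H1, w 0 = w₀ ∧ (∀ t, HasDerivAt w (h.field (w t)) t) ∧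
      ∀ t, ‖w t‖ ≤ C * ‖w₀‖ := by
  obtain ⟨k, K, hk, hK, hE⟩ := h.exists_energy_bounds
  refine ⟨Real.sqrt (K / k), by positivity, fun w₀ hw₀ => ?_⟩
  obtain ⟨-, M, -, hM0, -, hM⟩ := h.lipBall_field.exists_bound 2
  have hG : LipBall fun w : H1 => cutoff w • h.field w :=
    LipBall.bilin (ContinuousLinearMap.lsmul ℝ ℝ) lipBall_cutoff h.lipBall_field
  obtain ⟨w, hw0, hw⟩ := hG.exists_integralCurve (M := M) (fun x => by
    rw [norm_smul, Real.norm_eq_abs]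
    rcases le_total ‖x‖ 2 with hx | hx
    · exact (mul_le_of_le_one_left (norm_nonneg _) (abs_cutoff_le_one x)).trans (hM x hx)
    · rw [cutoff_eq_zero hx, abs_zero, zero_mul]
      exact hM0) w₀
  have hcons (t : ℝ) : h.energy (w t) = h.energy w₀ := by
    have hd (t : ℝ) : HasDerivAt (fun t => h.energy (w t)) 0 t := by
      refine ((h.hasFDerivAt_energy (w t)).comp_hasDerivAt t (hw t)).congr_deriv ?_
      rw [map_smul, h.energyDeriv_field, smul_zero]
    rw [← hw0]
    exact is_const_of_deriv_eq_zero (fun t => (hd t).differentiableAt) (fun t => (hd t).deriv) t 0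
  have hbd (t : ℝ) : ‖w t‖ ≤ Real.sqrt (K / k) * ‖w₀‖ := by
    refine (sq_le_sq₀ (norm_nonneg _) (by positivity)).1 ?_
    rw [mul_pow, Real.sq_sqrt (by positivity), div_mul_eq_mul_div, le_div_iff₀' hk]
    exact (hE (w t)).1.trans ((hcons t).le.trans (hE w₀).2)
  refine ⟨w, hw0, fun t => ?_, hbd⟩
  have := hw t
  rwa [cutoff_eq_one ((hbd t).trans hw₀), one_smul] at this

end Coeffs

/-- The inclusion `H^k ⊆ H¹` for `k ≥ 1`. -/
noncomputable def trunc {k : ℕ} : sobolev (k + 1) →L[ℝ] H1 :=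
  LinearMap.mkContinuous
    { toFun := fun w => mkH1 (comp 0 w) (comp 1 w) (w.2 0)
      map_add' := fun w w' => H1.ext ((comp 0).map_add w w') ((comp 1).map_add w w')
      map_smul' := fun a w => H1.ext ((comp 0).map_smul a w) ((comp 1).map_smul a w) }
    (‖(comp 0 : sobolev (k + 1) →L[ℝ] L2)‖ + ‖(comp 1 : sobolev (k + 1) →L[ℝ] L2)‖) fun w => by
      refine (norm_H1_le _).trans ?_
      rw [add_mul]
      exact add_le_add ((comp 0).le_opNorm w) ((comp 1).le_opNorm w)

theorem comp_zero_trunc {k : ℕ} (w : sobolev (k + 1)) : comp 0 (trunc w) = comp 0 w := rfl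

theorem comp_one_trunc {k : ℕ} (w : sobolev (k + 1)) : comp 1 (trunc w) = comp 1 w := rfl

theorem sobolev_ext {k : ℕ} {w w' : sobolev k} (h : comp 0 w = comp 0 w') : w = w' := by
  refine Subtype.ext (PiLp.ext fun j => ?_)
  change comp j w = comp j w'
  induction j using Fin.induction with
  | zero => exact h
  | succ j ih =>
    have h1 : IsWeakDeriv (comp j.castSucc w) (comp j.succ w) := w.2 j
    have h2 : IsWeakDeriv (comp j.castSucc w') (comp j.succ w') := w'.2 j
    exact h1.unique (ih ▸ h2)

theorem trunc_injective {k : ℕ} : Function.Injective (trunc : sobolev (k + 1) → H1) :=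
  fun w w' h => sobolev_ext (by rw [← comp_zero_trunc, h, comp_zero_trunc])

theorem normH1_eq_norm_trunc {k : ℕ} (w : sobolev (k + 1)) : normH1 w = ‖trunc w‖ := by
  have e : normH1 w = Real.sqrt (‖comp 0 w‖ ^ 2 + ‖comp 1 w‖ ^ 2) := by
    rw [normH1, Finset.sum_filter, Fin.sum_univ_succ, Fin.sum_univ_succ]
    have : ∀ i : Fin k, ¬ (i.succ.succ).val ≤ 1 := fun i => by simp
    simp only [this, if_false, Finset.sum_const_zero, add_zero]
    rfl
  rw [e, ← comp_zero_trunc, ← comp_one_trunc, ← norm_sq_H1, Real.sqrt_sq (norm_nonneg _)]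

/-- The element of `H²` with given function and derivative in `H¹`. -/
noncomputable def mkH2 (w v : H1) (h : comp 1 w = comp 0 v) : sobolev 2 :=
  ⟨WithLp.toLp 2 ![comp 0 w, comp 1 w, comp 1 v], fun j => by
    fin_cases j
    · exact isWeakDeriv_comp w
    · change IsWeakDeriv (comp 1 w) (comp 1 v)
      rw [h]
      exact isWeakDeriv_comp v⟩

theorem trunc_mkH2 (w v : H1) (h : comp 1 w = comp 0 v) : trunc (mkH2 w v h) = w :=
  H1.ext rfl rfl

theorem continuous_mkH2 {X : Type*} [TopologicalSpace X] {w v : X → H1}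
    (h : ∀ x, comp 1 (w x) = comp 0 (v x)) (hw : Continuous w) (hv : Continuous v) :
    Continuous fun x => mkH2 (w x) (v x) (h x) := by
  refine Continuous.subtype_mk ((PiLp.continuous_toLp 2 _).comp (continuous_pi fun j => ?_)) _
  fin_cases j
  · exact (comp 0).continuous.comp hw
  · exact (comp 1).continuous.comp hw
  · exact (comp 1).continuous.comp hv

/-- A `C¹` curve in `H¹` whose derivative in `z` is a `C¹` curve in `H¹` is a `C¹` curve
in `H²`. -/
theorem exists_curve_H2 {w v w' v' : ℝ → H1} (hw : ∀ t, HasDerivAt w (w' t) t)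
    (hv : ∀ t, HasDerivAt v (v' t) t) (hw' : Continuous w') (hv' : Continuous v')
    (h : ∀ t, comp 1 (w t) = comp 0 (v t)) :
    ∃ p : ℝ → sobolev 2, ContDiff ℝ 1 p ∧ ∀ t, trunc (p t) = w t := by
  have h' (t : ℝ) : comp 1 (w' t) = comp 0 (v' t) := by
    have h1 : HasDerivAt (fun t => comp 1 (w t)) (comp 1 (w' t)) t :=
      (comp 1).hasFDerivAt.comp_hasDerivAt t (hw t)
    have h2 : HasDerivAt (fun t => comp 0 (v t)) (comp 0 (v' t)) t :=
      (comp 0).hasFDerivAt.comp_hasDerivAt t (hv t)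
    simp only [h] at h1
    exact h1.unique h2
  have hc := continuous_mkH2 h' hw' hv'
  set q : ℝ → sobolev 2 := fun t => mkH2 (w' t) (v' t) (h' t) with hq
  set p : ℝ → sobolev 2 := fun t => mkH2 (w 0) (v 0) (h 0) + ∫ s in (0 : ℝ)..t, q s
  have hp (t : ℝ) : HasDerivAt p (q t) t :=
    ((hc.integral_hasStrictDerivAt 0 t).hasDerivAt).const_add _
  refine ⟨p, contDiff_one_iff_deriv.2 ⟨fun t => (hp t).differentiableAt, ?_⟩, fun t => ?_⟩
  · rw [show deriv p = q from funext fun t => (hp t).deriv]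
    exact hc
  · have hd (t : ℝ) : HasDerivAt (fun t => trunc (p t) - w t) 0 t := by
      refine (HasDerivAt.sub (trunc.hasFDerivAt.comp_hasDerivAt t (hp t)) (hw t)).congr_deriv ?_
      rw [hq, trunc_mkH2, sub_self]
    have := is_const_of_deriv_eq_zero (fun t => (hd t).differentiableAt) (fun t => (hd t).deriv) t 0
    simp only [p, intervalIntegral.integral_same, add_zero, trunc_mkH2, sub_self] at this
    exact sub_eq_zero.1 this

namespace Coeffs

variable {α β : ℝ → ℝ} {c : ℝ}

/-- Propagation of `H²` regularity. -/
theorem exists_lift_H2 (h : Coeffs α β c) {w : ℝ → H1} (hw : ∀ t, HasDerivAt w (h.field (w t)) t)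
    {p₀ : sobolev 2} (h0 : w 0 = trunc p₀) :
    ∃ p : ℝ → sobolev 2, ContDiff ℝ 1 p ∧ ∀ t, trunc (p t) = w t := by
  have hwc : Continuous w := continuous_iff_continuousAt.2 fun t => (hw t).continuousAt
  have hfc : Continuous fun t => h.field (w t) := h.lipBall_field.continuous.comp hwc
  have hvc : Continuous fun t => h.velDeriv (w t) := h.lipBall_velDeriv.continuous.comp hwc
  set ω₀ : H1 := mkH1 (comp 1 p₀) (comp 2 p₀) (p₀.2 1)
  set ρ : ℝ → H1 := fun t => nemFDeriv h.bdd_stream (w 0) ω₀ + ∫ s in (0 : ℝ)..t, h.velDeriv (w s)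
  have hρ (t : ℝ) : HasDerivAt ρ (h.velDeriv (w t)) t :=
    ((hvc.integral_hasStrictDerivAt 0 t).hasDerivAt).const_add _
  have hρc : Continuous ρ := continuous_iff_continuousAt.2 fun t => (hρ t).continuousAt
  have hρ0 : comp 0 (ρ 0) = comp 1 (nem h.bdd_stream (w 0)) := by
    simp only [ρ, intervalIntegral.integral_same, add_zero]
    refine Lp.ext ?_
    filter_upwards [coeFn_nemFDeriv h.bdd_stream (w 0) ω₀, coeFn_nemDeriv h.bdd_stream (w 0)]
      with z h1 h2
    rw [h1, comp_one_nem, h2, h0, comp_one_trunc]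
    rfl
  have hρw (t : ℝ) : comp 0 (ρ t) = comp 1 (nem h.bdd_stream (w t)) := by
    have hd (t : ℝ) : HasDerivAt (fun t => comp 0 (ρ t) - comp 1 (nem h.bdd_stream (w t))) 0 t := by
      have h1 : HasDerivAt (fun t => comp 0 (ρ t)) (comp 0 (h.velDeriv (w t))) t :=
        (comp 0).hasFDerivAt.comp_hasDerivAt t (hρ t)
      have h2 : HasDerivAt (fun t => nem h.bdd_stream (w t))
          (nemFDeriv h.bdd_stream (w t) (h.field (w t))) t :=
        (hasFDerivAt_nem h.bdd_stream (w t)).comp_hasDerivAt t (hw t)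
      have h3 : HasDerivAt (fun t => comp 1 (nem h.bdd_stream (w t)))
          (comp 1 (nemFDeriv h.bdd_stream (w t) (h.field (w t)))) t :=
        (comp 1).hasFDerivAt.comp_hasDerivAt t h2
      refine (h1.sub h3).congr_deriv ?_
      rw [h.nemFDeriv_stream_field, comp_zero_velDeriv, sub_self]
    have := is_const_of_deriv_eq_zero (fun t => (hd t).differentiableAt) (fun t => (hd t).deriv) t 0
    simp only [hρ0, sub_self] at this
    exact sub_eq_zero.1 this
  have hb (t : ℝ) : HasDerivAt (fun t => nem h.bdd_snd (w t))
      (nemFDeriv h.bdd_snd (w t) (h.field (w t))) t :=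
    (hasFDerivAt_nem h.bdd_snd (w t)).comp_hasDerivAt t (hw t)
  have hbc : Continuous fun t => nem h.bdd_snd (w t) := (lipBall_nem h.bdd_snd).continuous.comp hwc
  have hv (t : ℝ) : HasDerivAt (fun t => ρ t + mulH1 (nem h.bdd_snd (w t)) (ρ t))
      (h.velDeriv (w t) + (mulH1 (nem h.bdd_snd (w t)) (h.velDeriv (w t)) +
        mulH1 (nemFDeriv h.bdd_snd (w t) (h.field (w t))) (ρ t))) t :=
    (hρ t).add (mulH1.hasDerivAt_of_bilinear (fun _ => hb t) (fun _ => hρ t))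
  refine exists_curve_H2 hw hv hfc ?_ fun t => ?_
  · have c1 : Continuous fun t => mulH1 (nem h.bdd_snd (w t)) (h.velDeriv (w t)) :=
      (mulH1.continuous.comp hbc).clm_apply hvc
    have c2 : Continuous fun t => mulH1 (nemFDeriv h.bdd_snd (w t) (h.field (w t))) (ρ t) :=
      (mulH1.continuous.comp (continuous_nemFDeriv_apply h.bdd_snd hwc hfc)).clm_apply hρc
    exact hvc.add (c1.add c2)
  · rw [map_add]
    refine Lp.ext ?_
    filter_upwards [Lp.coeFn_add (comp 0 (ρ t)) (comp 0 (mulH1 (nem h.bdd_snd (w t)) (ρ t))),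
      coeFn_mulH1 (nem h.bdd_snd (w t)) (ρ t), coeFn_nem h.bdd_snd (w t),
      coeFn_nemDeriv h.bdd_stream (w t)] with z h1 h2 h3 h4
    rw [h1, Pi.add_apply, h2, h3, hρw, comp_one_nem, h4, h.deriv_stream]
    have := (h.snd_pos (comp 0 (w t) z)).ne'
    field_simp

end Coeffs

/-- A cut-off on the real line. -/
noncomputable def bump : ContDiffBump (0 : ℝ) where
  rIn := 1 / 2
  rOut := 3 / 4
  rIn_pos := by norm_num
  rIn_lt_rOut := by norm_num

/-- The function `(1 + x) ^ n - 1`, cut off near `x = -1` and at infinity. -/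
noncomputable def cutPow (n x : ℝ) : ℝ := bump x * ((1 + x) ^ n - 1)

theorem contDiff_cutPow (n : ℝ) : ContDiff ℝ ∞ (cutPow n) := by
  rw [contDiff_iff_contDiffAt]
  intro x
  by_cases hx : x ∈ tsupport (bump : ℝ → ℝ)
  · rw [bump.tsupport_eq, mem_closedBall_zero_iff, Real.norm_eq_abs] at hx
    have h1 : 1 + x ≠ 0 := by
      have := (abs_le.1 hx).1
      change -(3 / 4) ≤ x at this
      linarith
    exact bump.contDiff.contDiffAt.mul
      (((contDiffAt_const.add contDiffAt_id).rpow_const_of_ne h1).sub contDiffAt_const)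
  · have : cutPow n =ᶠ[𝓝 x] fun _ => 0 := by
      filter_upwards [notMem_tsupport_iff_eventuallyEq.1 hx] with y hy
      rw [cutPow, hy, Pi.zero_apply, zero_mul]
    exact contDiffAt_const.congr_of_eventuallyEq this

theorem hasCompactSupport_cutPow (n : ℝ) : HasCompactSupport (cutPow n) :=
  bump.hasCompactSupport.mul_right

theorem cutPow_zero (n : ℝ) : cutPow n 0 = 0 := by simp [cutPow]

theorem one_add_cutPow {n x : ℝ} (hx : |x| ≤ 1 / 2) : 1 + cutPow n x = (1 + x) ^ n := by
  rw [cutPow, bump.one_of_mem_closedBall (by simpa [bump] using hx)]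
  ring

theorem exists_le_one_add_cutPow (n : ℝ) : ∃ c : ℝ, 0 < c ∧ ∀ x, c ≤ 1 + cutPow n x := by
  have hpos : ∀ x ∈ Icc (-(3 / 4) : ℝ) (3 / 4), 0 < 1 + x := fun x hx => by linarith [hx.1]
  have hcont : ContinuousOn (fun x : ℝ => (1 + x) ^ n) (Icc (-(3 / 4)) (3 / 4)) :=
    (continuousOn_const.add continuousOn_id).rpow_const fun x hx => Or.inl (hpos x hx).ne'
  obtain ⟨y, hy, hmin⟩ := isCompact_Icc.exists_isMinOn ⟨0, by norm_num, by norm_num⟩ hcont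
  refine ⟨min 1 ((1 + y) ^ n), lt_min one_pos (Real.rpow_pos_of_pos (hpos y hy) n), fun x => ?_⟩
  have b0 : 0 ≤ bump x := bump.nonneg
  have b1 : bump x ≤ 1 := bump.le_one
  by_cases hx : x ∈ Icc (-(3 / 4) : ℝ) (3 / 4)
  · have h1 : min 1 ((1 + y) ^ n) ≤ (1 + x) ^ n := (min_le_right _ _).trans (hmin hx)
    have h2 : min 1 ((1 + y) ^ n) ≤ 1 := min_le_left _ _
    rw [cutPow]
    nlinarith
  · have : bump x = 0 := by
      refine bump.zero_of_le_dist ?_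
      rw [dist_zero_right, Real.norm_eq_abs]
      by_contra hlt
      exact hx (abs_le.1 (not_le.1 hlt).le)
    rw [cutPow, this, zero_mul, add_zero]
    exact min_le_left _ _

theorem exists_coeffs (n m : ℝ) : ∃ c, Coeffs (cutPow n) (cutPow m) c := by
  obtain ⟨c1, h1, h1'⟩ := exists_le_one_add_cutPow n
  obtain ⟨c2, h2, h2'⟩ := exists_le_one_add_cutPow m
  exact ⟨min c1 c2, contDiff_cutPow n, contDiff_cutPow m, hasCompactSupport_cutPow n,
    hasCompactSupport_cutPow m, cutPow_zero n, cutPow_zero m, lt_min h1 h2,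
    fun x => (min_le_left _ _).trans (h1' x), fun x => (min_le_right _ _).trans (h2' x)⟩

theorem integral_deriv_test {v : ℝ → ℝ} (hv : ContDiff ℝ ∞ v) (hc : HasCompactSupport v) :
    ∫ z, deriv v z = 0 :=
  integral_eq_zero_of_hasDerivAt_of_integrable
    (fun z => (hv.differentiable (by simp) z).hasDerivAt)
    ((hv.continuous_deriv (by simp)).integrable_of_hasCompactSupport hc.deriv)
    (hv.continuous.integrable_of_hasCompactSupport hc)

/-- For small `w` the cut-off elliptic equation is the original one. -/
theorem solvesElliptic_iff {n m c : ℝ} (h : Coeffs (cutPow n) (cutPow m) c) {w u : H1}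
    (hw : ‖w‖ ≤ 1 / 2) {φ : ℝ → ℝ} (hφ : ∀ z, φ z = 1 + comp 0 w z) :
    SolvesElliptic n m φ u ↔ h.Sol w u := by
  rw [Coeffs.Sol, ellipticSol_iff_test, SolvesElliptic]
  refine forall_congr' fun v => forall_congr' fun hv => forall_congr' fun hc => ?_
  have hv' : Continuous (deriv v) := hv.continuous_deriv (by simp)
  set A := compLinf h.bdd_fst (toLinf w)
  set B := compLinf h.bdd_snd (toLinf w)
  set r := compL2 h.bdd_fst (comp 0 w)
  have hsmall : ∀ᵐ z, |comp 0 w z| ≤ 1 / 2 := by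
    filter_upwards [ae_abs_le_norm w] with z hz
    exact hz.trans hw
  have e1 : ∫ z, (φ z ^ n * D u 1 z * deriv v z + φ z ^ m * D u 0 z * v z) =
      (∫ z, (comp 1 u + mulL A (comp 1 u) : L2) z * deriv v z) +
        ∫ z, (comp 0 u + mulL B (comp 0 u) : L2) z * v z := by
    rw [← integral_add (integrable_mul_test _ hv' hc.deriv)
      (integrable_mul_test _ hv.continuous hc)]
    refine integral_congr_ae ?_
    filter_upwards [hsmall, Lp.coeFn_add (comp 1 u) (mulL A (comp 1 u)),
      Lp.coeFn_add (comp 0 u) (mulL B (comp 0 u)), coeFn_mulL A (comp 1 u),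
      coeFn_mulL B (comp 0 u), coeFn_compLinf h.bdd_fst (toLinf w),
      coeFn_compLinf h.bdd_snd (toLinf w), coeFn_toLinf w] with z h0 h1 h2 h3 h4 h5 h6 h7
    rw [h1, h2, Pi.add_apply, Pi.add_apply, h3, h4, h5, h6, h7, hφ, ← one_add_cutPow h0,
      ← one_add_cutPow h0, D_eq_comp, D_eq_comp]
    ring
  have e2 : ∫ z, φ z ^ n * deriv v z = ∫ z, r z * deriv v z := by
    have : ∫ z, φ z ^ n * deriv v z = ∫ z, (deriv v z + r z * deriv v z) := by
      refine integral_congr_ae ?_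
      filter_upwards [hsmall, coeFn_compL2 h.bdd_fst (comp 0 w)] with z h0 h1
      rw [h1, hφ, ← one_add_cutPow h0]
      ring
    rw [this, integral_add (hv'.integrable_of_hasCompactSupport hc.deriv)
      (integrable_mul_test _ hv' hc.deriv), integral_deriv_test hv hc, zero_add]
  rw [e1, e2]

section Solution

variable {n m c : ℝ} {k : ℕ}

/-- A small `C¹` curve in `H^k` that moves along the vector field is a global solution. -/
theorem isGlobalSolution_of_field (h : Coeffs (cutPow n) (cutPow m) c)
    {p : ℝ → sobolev (k + 1)} (hp : ContDiff ℝ 1 p)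
    (hd : ∀ t, HasDerivAt (fun t => trunc (p t)) (h.field (trunc (p t))) t)
    (hs : ∀ t, ‖trunc (p t)‖ ≤ 1 / 2) : IsGlobalSolution n m p where
  contDiffOn := hp.contDiffOn
  pos t _ := by
    obtain ⟨φ, hφ, hae, hb⟩ := exists_continuous_rep (trunc (p t))
    refine ⟨fun z => 1 + φ z, continuous_const.add hφ, ?_, fun z => ?_⟩
    · filter_upwards [hae] with z hz
      rw [hz]
      rfl
    · have := (abs_le.1 ((hb z).trans (hs t))).1
      linarith
  eqn t ht := by
    refine ⟨h.vel (trunc (p t)), (solvesElliptic_iff h (hs t) fun z => rfl).2 (h.sol_vel _), ?_⟩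
    have hdt : DifferentiableAt ℝ p t := hp.differentiable one_ne_zero t
    have e : trunc (derivWithin p (Ici 0) t) = h.field (trunc (p t)) := by
      rw [hdt.derivWithin (uniqueDiffOn_Ici 0 t ht)]
      have h1 : HasDerivAt (fun t => trunc (p t)) (trunc (deriv p t)) t :=
        trunc.hasFDerivAt.comp_hasDerivAt t hdt.hasDerivAt
      exact h1.unique (hd t)
    rw [D_eq_comp, ← comp_zero_trunc, e]
    filter_upwards [h.coeFn_field (trunc (p t)), ae_abs_le_norm (trunc (p t))] with z h1 h2
    rw [h1, one_add_cutPow (h2.trans (hs t))]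
    rfl

/-- A global solution moves along the vector field whenever it is small. -/
theorem IsGlobalSolution.hasDerivWithinAt (h : Coeffs (cutPow n) (cutPow m) c)
    {q : ℝ → sobolev (k + 1)} (hq : IsGlobalSolution n m q) {t : ℝ} (ht : 0 ≤ t)
    (hs : ‖trunc (q t)‖ ≤ 1 / 2) :
    HasDerivWithinAt (fun t => trunc (q t)) (h.field (trunc (q t))) (Ici 0) t := by
  have hd : HasDerivWithinAt (fun t => trunc (q t)) (trunc (derivWithin q (Ici 0) t)) (Ici 0) t :=
    trunc.hasFDerivAt.comp_hasDerivWithinAt t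
      (hq.contDiffOn.differentiableOn one_ne_zero t ht).hasDerivWithinAt
  obtain ⟨u, hu, he⟩ := hq.eqn t ht
  have hu' : u = h.vel (trunc (q t)) := ((solvesElliptic_iff h hs fun z => rfl).1 hu).eq_vel
  have e : trunc (derivWithin q (Ici 0) t) = h.field (trunc (q t)) := by
    refine H1.ext_zero (Lp.ext ?_)
    rw [comp_zero_trunc, ← D_eq_comp]
    filter_upwards [he, h.coeFn_field (trunc (q t)), ae_abs_le_norm (trunc (q t))] with z h1 h2 h3
    rw [h1, h2, one_add_cutPow (h3.trans hs), hu']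
    rfl
  rwa [e] at hd

theorem IsGlobalSolution.eq_flow (h : Coeffs (cutPow n) (cutPow m) c)
    {q : ℝ → sobolev (k + 1)} (hq : IsGlobalSolution n m q) {w : ℝ → H1} (h0 : trunc (q 0) = w 0)
    (hw : ∀ t, HasDerivAt w (h.field (w t)) t) (hs : ∀ t, ‖w t‖ < 1 / 2) {t : ℝ} (ht : 0 ≤ t) :
    trunc (q t) = w t := by
  have hqc : ContinuousOn (fun t => trunc (q t)) (Ici 0) :=
    trunc.continuous.comp_continuousOn hq.contDiffOn.continuousOn
  have hwc : Continuous w := continuous_iff_continuousAt.2 fun t => (hw t).continuousAt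
  have hsub : Icc 0 t ⊆ {s | trunc (q s) = w s} := by
    refine IsClosed.Icc_subset_of_forall_mem_nhdsWithin ?_ h0 fun s hs' => ?_
    · have := ((hqc.mono Icc_subset_Ici_self).prodMk (hwc.continuousOn (s := Icc 0 t)))
        |>.preimage_isClosed_of_isClosed isClosed_Icc isClosed_diagonal
      rw [inter_comm]
      exact this
    · obtain ⟨heq, hs0, -⟩ := hs'
      have hqs : ContinuousWithinAt (fun t => ‖trunc (q t)‖) (Ici s) s :=
        ((hqc s hs0).mono (Ici_subset_Ici.2 hs0)).norm
      have hlt : ‖trunc (q s)‖ < 1 / 2 := by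
        rw [heq]
        exact hs s
      obtain ⟨b, hb, hbs⟩ := (mem_nhdsGE_iff_exists_Icc_subset).1 (hqs.eventually_lt_const hlt)
      have hb0 : Icc s b ⊆ Ici 0 := Icc_subset_Ici_self.trans (Ici_subset_Ici.2 hs0)
      have := h.lipBall_field.ode_unique_right (f := fun t => trunc (q t)) (g := w) (a := s) (b := b)
        (hqc.mono hb0)
        (fun r hr => (hq.hasDerivWithinAt h (hb0 (Ico_subset_Icc_self hr))
          (le_of_lt (hbs (Ico_subset_Icc_self hr)))).mono
            (Ici_subset_Ici.2 (hb0 (Ico_subset_Icc_self hr))))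
        hwc.continuousOn (fun r _ => (hw r).hasDerivWithinAt) heq
      exact mem_of_superset (Ioc_mem_nhdsGT hb) fun r hr => this (Ioc_subset_Icc_self hr)
  exact hsub ⟨ht, le_rfl⟩

/-- Well-posedness, given that the flow lifts to `H^k`. -/
theorem wellposed_of_lift (h : Coeffs (cutPow n) (cutPow m) c) {p₀ : sobolev (k + 1)} {w : ℝ → H1}
    {η : ℝ} (hη : η < 1 / 2) (h0 : w 0 = trunc p₀) (hw : ∀ t, HasDerivAt w (h.field (w t)) t)
    (hs : ∀ t, ‖w t‖ ≤ η)
    (hlift : ∃ p : ℝ → sobolev (k + 1), ContDiff ℝ 1 p ∧ ∀ t, trunc (p t) = w t) :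
    ∃ p : ℝ → sobolev (k + 1), (IsGlobalSolution n m p ∧ p 0 = p₀) ∧
      (∀ q : ℝ → sobolev (k + 1), IsGlobalSolution n m q → q 0 = p₀ →
        ∀ t : ℝ, 0 ≤ t → q t = p t) ∧
      ∀ t : ℝ, 0 ≤ t → normH1 (p t) ≤ η := by
  obtain ⟨p, hp, hpw⟩ := hlift
  refine ⟨p, ⟨isGlobalSolution_of_field h hp ?_ fun t => ?_, ?_⟩, fun q hq hq0 t ht => ?_,
    fun t _ => ?_⟩
  · simpa only [hpw] using hw
  · rw [hpw]
    exact (hs t).trans hη.le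
  · exact trunc_injective ((hpw 0).trans h0)
  · refine trunc_injective ?_
    rw [hpw]
    exact hq.eq_flow h (by rw [hq0, h0]) hw (fun s => (hs s).trans_lt hη) ht
  · rw [normH1_eq_norm_trunc, hpw]
    exact hs t

end Solution

end Magma

theorem mainTheorem4 (n m : ℝ) :
    ∃ ηc : ℝ, 0 < ηc ∧ ∀ η : ℝ, 0 < η → η < ηc →
      ∃ δ : ℝ, 0 < δ ∧ ∀ k : ℕ, (k = 1 ∨ k = 2) →
        ∀ p₀ : Magma.sobolev k, Magma.normH1 p₀ ≤ δ →
          ∃ p : ℝ → Magma.sobolev k,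
            (Magma.IsGlobalSolution n m p ∧ p 0 = p₀) ∧
            (∀ q : ℝ → Magma.sobolev k, Magma.IsGlobalSolution n m q → q 0 = p₀ →
              ∀ t : ℝ, 0 ≤ t → q t = p t) ∧
            (∀ t : ℝ, 0 ≤ t → Magma.normH1 (p t) ≤ η) := by
  obtain ⟨c, h⟩ := Magma.exists_coeffs n m
  obtain ⟨C, hC, hflow⟩ := h.exists_flow
  refine ⟨1 / 2, by norm_num, fun η hη hη2 => ⟨η / C, div_pos hη hC, fun k hk p₀ hp₀ => ?_⟩⟩
  rcases hk with rfl | rfl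
  · rw [Magma.normH1_eq_norm_trunc (k := 0), le_div_iff₀' hC] at hp₀
    obtain ⟨w, hw0, hw, hwb⟩ := hflow (Magma.trunc (k := 0) p₀) (by linarith)
    refine Magma.wellposed_of_lift (k := 0) h hη2 hw0 hw (fun t => (hwb t).trans hp₀)
      ⟨w, contDiff_one_iff_deriv.2 ⟨fun t => (hw t).differentiableAt, ?_⟩,
        fun t => Magma.H1.ext rfl rfl⟩
    rw [show deriv w = fun t => h.field (w t) from funext fun t => (hw t).deriv]
    exact h.lipBall_field.continuous.comp
      (continuous_iff_continuousAt.2 fun t => (hw t).continuousAt)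
  · rw [Magma.normH1_eq_norm_trunc (k := 1), le_div_iff₀' hC] at hp₀
    obtain ⟨w, hw0, hw, hwb⟩ := hflow (Magma.trunc (k := 1) p₀) (by linarith)
    exact Magma.wellposed_of_lift (k := 1) h hη2 hw0 hw (fun t => (hwb t).trans hp₀)
      (h.exists_lift_H2 hw hw0)
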